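/- Let $X$ be a compact connected (Hausdorff) abelian group of finite dimension, i.e. whose character group $\hat X$ has finite rank (equivalently, $\hat X$ embeds in $\mathbb{Q}^d$ for some $d$), with normalized Haar measure $m$ on the completion of its Borel $\sigma$-algebra, and let $\Gamma$ be a solvable subgroup of the group $\mathrm{Aut}(X)$ of continuous automorphisms of $X$. Then the following statements are equivalent: (a) $\Gamma$ is hereditarily ergodic: for every closed connected subgroup $Y\subset X$ such that $\Gamma_Y=\{\gamma\in\Gamma:\gamma Y\subset Y\}$ is a subgroup of finite index in $\Gamma$, the action of $\Gamma_Y$ on $Y$ is ergodic with respect to the normalized Haar measure of $Y$ (every measurable $\Gamma_Y$-invariant subset of $Y$ has measure $0$ or $1$). (b) $\Gamma$ contains an abelian subgroup $\Lambda$ which is mixing of all orders: $\Lambda$ is infinite (unless $X$ is trivial) and, for every $s\ge 1$ and all measurable $B_1,\dots,B_s\subset X$, $$m\bigl(\gamma_1^{-1}B_1\cap(\gamma_2\gamma_1)^{-1}B_2\cap\cdots\cap(\gamma_s\cdots\gamma_1)^{-1}B_s\bigr)\to m(B_1)\cdots m(B_s)$$ as $\gamma_1,\dots,\gamma_s\in\Lambda$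 vary so that every product $\gamma_j\cdots\gamma_i$ with $1<i\le j\le s$ tends to infinity (eventually leaves every finite subset of $\Lambda$). (c) $\Gamma$ contains an element $\gamma$ which is mixing of all orders: for every $s\ge1$, all measurable $B_1,\dots,B_s\subset X$ and $n_1,\dots,n_s\in\mathbb{N}$, $$m(\gamma^{-n_1}B_1\cap\cdots\cap\gamma^{-n_s}B_s)\to m(B_1)\cdots m(B_s)\quad\text{as } |n_i-n_j|\to\infty \text{ for all } i\ne j.$$ -/

import Mathlib

open MeasureTheory Filter Topology

noncomputable section

/-- The group `Aut(X)` of continuous automorphisms (with continuous inverse) of a topological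
group, as a subgroup of the group of all abstract automorphisms. -/
def continuousAut (X : Type*) [Group X] [TopologicalSpace X] : Subgroup (MulAut X) where
  carrier := {φ | Continuous φ ∧ Continuous (φ⁻¹ : MulAut X)}
  one_mem' := ⟨continuous_id, continuous_id⟩
  mul_mem' := by
    rintro a b ⟨ha, ha'⟩ ⟨hb, hb'⟩
    refine ⟨ha.comp hb, ?_⟩
    rw [mul_inv_rev]
    exact hb'.comp ha'
  inv_mem' := by
    rintro a ⟨ha, ha'⟩
    exact ⟨ha', by rwa [inv_inv]⟩

/-- The dimension of a compact connected abelian group: the rank of its (discrete, torsion-free)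
character group, that is, the dimension of the rational vector space `X̂ ⊗ ℚ`. -/
def charDim (X : Type*) [CommGroup X] [TopologicalSpace X] : Cardinal :=
  Module.rank ℤ (Additive (PontryaginDual X))

/-- The Haar probability measure of a compact group. -/
def normalizedHaar (X : Type*) [Group X] [TopologicalSpace X] [IsTopologicalGroup X]
    [CompactSpace X] [MeasurableSpace X] [BorelSpace X] : Measure X :=
  Measure.haarMeasure (⊤ : TopologicalSpace.PositiveCompacts X)

/-- A family `F` of self-maps is ergodic for the probability measure `μ` if every invariant set
that is measurable for the completion of `μ` has measure `0` or `1`. -/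
def IsErgodicFamily {Ω : Type*} [MeasurableSpace Ω] (μ : Measure Ω) (F : Set (Ω → Ω)) : Prop :=
  ∀ A : Set Ω, NullMeasurableSet A μ → (∀ f ∈ F, f ⁻¹' A = A) → μ A = 0 ∨ μ A = 1

/-- `Γ_Y = {γ ∈ Γ : γ Y ⊆ Y}`. -/
def stabPart {X : Type*} [Group X] (Γ : Subgroup (MulAut X)) (Y : Subgroup X) :
    Set (MulAut X) :=
  {γ | γ ∈ Γ ∧ ∀ y ∈ Y, γ y ∈ Y}

/-- `Y` is virtually `Γ`-invariant: `Γ_Y` is a subgroup of finite index in `Γ`. -/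
def IsVirtuallyInvariant {X : Type*} [Group X] (Γ : Subgroup (MulAut X)) (Y : Subgroup X) :
    Prop :=
  ∃ Δ : Subgroup (MulAut X), (Δ : Set (MulAut X)) = stabPart Γ Y ∧ Δ.relIndex Γ ≠ 0

/-- `Γ` is hereditarily ergodic: for every closed connected virtually `Γ`-invariant subgroup `Y`,
the action of `Γ_Y` on `Y` by restriction is ergodic for the Haar probability measure of `Y`. -/
def IsHereditarilyErgodic {X : Type*} [Group X] [TopologicalSpace X] [IsTopologicalGroup X]
    [CompactSpace X] [MeasurableSpace X] [BorelSpace X] (Γ : Subgroup (MulAut X)) : Prop :=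
  ∀ (Y : Subgroup X) (hY : IsClosed (Y : Set X)), IsConnected (Y : Set X) →
    IsVirtuallyInvariant Γ Y →
      haveI : CompactSpace Y := isCompact_iff_compactSpace.mp hY.isCompact
      IsErgodicFamily (normalizedHaar Y) {f : Y → Y | ∃ γ ∈ stabPart Γ Y, ∀ y : Y, (f y : X) = γ y}

/-- `blockProd γ i n = γ (i + n) * ⋯ * γ (i + 1) * γ i`. -/
def blockProd {G : Type*} [Mul G] (γ : ℕ → G) (i : ℕ) : ℕ → G
  | 0 => γ i
  | n + 1 => γ (i + n + 1) * blockProd γ i n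

/-- `Λ` is mixing of order `s` (indices run over `0, …, s - 1`):
`m (γ₀⁻¹ B₀ ∩ (γ₁ γ₀)⁻¹ B₁ ∩ ⋯ ∩ (γₛ₋₁ ⋯ γ₀)⁻¹ Bₛ₋₁) → m B₀ ⋯ m Bₛ₋₁` when the products
`γⱼ ⋯ γᵢ`, `0 < i ≤ j < s`, all tend to infinity, i.e. leave every finite subset of `Λ`. -/
def IsMixingOfOrder {X : Type*} [Group X] [TopologicalSpace X] [IsTopologicalGroup X]
    [CompactSpace X] [MeasurableSpace X] [BorelSpace X] (Λ : Subgroup (MulAut X)) (s : ℕ) :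
    Prop :=
  ∀ B : ℕ → Set X, (∀ k, NullMeasurableSet (B k) (normalizedHaar X)) →
    Tendsto
      (fun γ : ℕ → Λ =>
        normalizedHaar X (⋂ k ∈ Finset.range s, ((blockProd γ 0 k : Λ) : MulAut X) ⁻¹' B k))
      (⨅ (i : ℕ) (n : ℕ) (_ : 0 < i ∧ i + n < s),
        comap (fun γ : ℕ → Λ => blockProd γ i n) cofinite)
      (𝓝 (∏ k ∈ Finset.range s, normalizedHaar X (B k)))

/-- A group of automorphisms is mixing of all orders. As usual, the notion is reserved for
infinite groups (for a finite group nothing tends to infinity), except when `X` is trivial. -/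
def IsMixingOfAllOrders {X : Type*} [Group X] [TopologicalSpace X] [IsTopologicalGroup X]
    [CompactSpace X] [MeasurableSpace X] [BorelSpace X] (Λ : Subgroup (MulAut X)) : Prop :=
  (Nontrivial X → Infinite Λ) ∧ ∀ s : ℕ, 1 ≤ s → IsMixingOfOrder Λ s

/-- A single automorphism `T` is mixing of all orders: for all `s ≥ 1` and measurable `Bᵢ`,
`m (⋂ᵢ T^{-nᵢ} Bᵢ) → ∏ᵢ m Bᵢ` as `|nᵢ - nⱼ| → ∞` for all `i ≠ j`. -/
def IsMixingElement {X : Type*} [Group X] [TopologicalSpace X] [IsTopologicalGroup X]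
    [CompactSpace X] [MeasurableSpace X] [BorelSpace X] (T : MulAut X) : Prop :=
  ∀ s : ℕ, 1 ≤ s → ∀ B : Fin s → Set X,
    (∀ k, NullMeasurableSet (B k) (normalizedHaar X)) →
    Tendsto
      (fun n : Fin s → ℕ => normalizedHaar X (⋂ k, (T ^ n k : MulAut X) ⁻¹' B k))
      (⨅ (i : Fin s) (j : Fin s) (_ : i ≠ j),
        comap (fun n : Fin s → ℕ => |(n i : ℤ) - (n j : ℤ)|) atTop)
      (𝓝 (∏ k, normalizedHaar X (B k)))

end

/-! Let V = ℚ ⊗ X̂. It is finite-dimensional, contains X̂ because X is connected, and carries a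
linear action of Γ. All three conditions are compared with an algebraic one: Γ contains an aperiodic
g (`IsAperiodic`), no positive power of which fixes a nontrivial character; equivalently, no
eigenvalue of g on V is a root of unity.

Aperiodic implies mixing. A product of characters moved by powers of g is a character, so its Haar
integral vanishes unless the corresponding sum of vectors gⁿⁱvᵢ is zero in V. On an irreducible
subquotient g acts as multiplication by some x in a number field, not a root of unity; by
Kronecker's theorem some absolute value has |x| ≠ 1, and the extreme exponent then dominates when
the exponents are far apart. Since characters span a dense space, g and the cyclic group it
generates are mixing of all orders. Aperiodicity survives powers and restriction to closed connected
invariant subgroups, which gives hereditary ergodicity.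

Mixing implies aperiodic. If a nontrivial character χ is fixed by infinitely many elements, the set
{Re χ > 0} violates mixing of order two. For a single automorphism this is aperiodicity; an infinite
abelian group needs in addition the representation theory below.

Hereditary ergodicity implies aperiodic. A virtually invariant subspace W of V is dual to a closed
connected virtually invariant Y, and a nonzero virtually fixed vector of V/W gives a nontrivial
character of Y with finite orbit, contradicting ergodicity on Y. So no V/W has such a vector. On a
virtually minimal subspace of V/W a finite-index subgroup acts strongly irreducibly, and solvability
makes its image commutative (`IsStronglyIrreducible.center_eq_top`). The elements acting with finite
order thus form a subgroup, of infinite index since nothing is virtually fixed. Climbing a flag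
leaves finitely many infinite-index subgroups to avoid, and B. H. Neumann's covering lemma provides
g. -/

/-! ### Finiteness of roots in commutative rational algebras -/

/-- A reduced Artinian ring embeds in the product of its finitely many residue domains, and each of
these contains finitely many roots. -/
theorem finite_setOf_aeval_eq_zero {R : Type*} [CommRing R] [IsArtinianRing R] [IsReduced R]
    [Algebra ℚ R] {p : Polynomial ℚ} (hp : p ≠ 0) :
    {x : R | Polynomial.aeval x p = 0}.Finite := by
  let F : R → (q : PrimeSpectrum R) → R ⧸ q.asIdeal := fun x q => Ideal.Quotient.mk q.asIdeal x
  have hF : Function.Injective F := by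
    intro x y hxy
    rw [← sub_eq_zero]
    have : x - y ∈ nilradical R := by
      rw [nilradical_eq_sInf, Submodule.mem_sInf]
      intro I hI
      exact Ideal.Quotient.eq.mp (congrFun hxy ⟨I, hI⟩)
    exact (mem_nilradical.mp this).eq_zero
  refine Set.Finite.of_finite_image (f := F) ?_ hF.injOn
  refine (Set.Finite.pi' (t := fun q : PrimeSpectrum R => p.rootSet (R ⧸ q.asIdeal))
    fun q => p.rootSet_finite _).subset ?_
  rintro _ ⟨x, hx, rfl⟩ q
  rw [Polynomial.mem_rootSet]
  refine ⟨hp, ?_⟩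
  have := Polynomial.aeval_algHom_apply (Ideal.Quotient.mkₐ ℚ q.asIdeal) x p
  rw [hx, map_zero] at this
  exact this

/-- Here R is a number field, and roots of unity are algebraic integers all of whose conjugates have
modulus one; there are finitely many of those. -/
theorem finite_setOf_isOfFinOrder {R : Type*} [CommRing R] [IsDomain R] [Algebra ℚ R]
    [FiniteDimensional ℚ R] : {x : R | IsOfFinOrder x}.Finite := by
  let _ : Field R := fieldOfFiniteDimensional ℚ R
  have : CharZero R := algebraRat.charZero R
  have : NumberField R := by
    have h : FiniteDimensional ℚ R := inferInstance
    refine { to_finiteDimensional := ?_ }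
    convert! h
    exact Subsingleton.elim _ _
  refine (NumberField.Embeddings.finite_of_norm_le R ℂ 1).subset ?_
  intro x hx
  obtain ⟨n, hn, hxn⟩ := hx.exists_pow_eq_one
  refine ⟨⟨Polynomial.X ^ n - 1, Polynomial.monic_X_pow_sub_C 1 hn.ne', by simp [hxn]⟩, ?_⟩
  intro φ
  exact (Complex.norm_eq_one_of_pow_eq_one (ζ := φ x) (by rw [← map_pow, hxn, map_one]) hn.ne').le

/-- Pigeonhole: the elements z ^ j * n have only finitely many images in the domain R ⧸ M. -/
theorem exists_pow_mul_mem_of_aeval_eq_zero {R : Type*} [CommRing R] [Algebra ℚ R] (M : Ideal R)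
    [M.IsPrime] {p : Polynomial ℚ} (hp : p ≠ 0) (z n : R)
    (h : ∀ j : ℕ, Polynomial.aeval (z ^ j * n) p = 0) :
    ∃ i k : ℕ, z ^ i * n * (z ^ (k + 1) - 1) ∈ M := by
  have hmem : ∀ j : ℕ, Ideal.Quotient.mk M (z ^ j * n) ∈ p.rootSet (R ⧸ M) := by
    intro j
    rw [Polynomial.mem_rootSet]
    refine ⟨hp, ?_⟩
    have h2 := Polynomial.aeval_algHom_apply (Ideal.Quotient.mkₐ ℚ M) (z ^ j * n) p
    rw [h j, map_zero] at h2
    exact h2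
  obtain ⟨i, -, j, -, hij, heq⟩ := Set.infinite_univ.exists_ne_map_eq_of_mapsTo
    (f := fun j : ℕ => Ideal.Quotient.mk M (z ^ j * n)) (fun j _ => hmem j)
    (p.rootSet_finite (R ⧸ M))
  wlog hlt : i < j generalizing i j
  · exact this j i hij.symm heq.symm (by lia)
  obtain ⟨k, rfl⟩ := Nat.exists_eq_add_of_lt hlt
  refine ⟨i, k, ?_⟩
  have : z ^ i * n * (z ^ (k + 1) - 1) = z ^ (i + k + 1) * n - z ^ i * n := by ring
  rw [this]
  exact Ideal.Quotient.eq.mp heq.symm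

/-! ### Strongly irreducible representations of solvable groups -/

section StronglyIrreducible

open scoped IsMulCommutative

variable {G : Type*} [Group G] {U : Type*} [AddCommGroup U] [Module ℚ U]

/-- Conjugation by `ρ g` as an endomorphism of the endomorphism algebra. -/
def conjAlgHom (ρ : G →* Module.End ℚ U) (g : G) : Module.End ℚ U →ₐ[ℚ] Module.End ℚ U :=
  AlgHom.ofLinearMap
    ((LinearMap.mulLeft ℚ (ρ g)).comp (LinearMap.mulRight ℚ (ρ g⁻¹)))
    (by simp [← map_mul])
    (by
      intro x y
      have h : ρ g⁻¹ * ρ g = 1 := by rw [← map_mul, inv_mul_cancel, map_one]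
      simp only [LinearMap.comp_apply, LinearMap.mulLeft_apply, LinearMap.mulRight_apply]
      calc ρ g * (x * y * ρ g⁻¹) = ρ g * x * 1 * y * ρ g⁻¹ := by simp only [mul_assoc, one_mul]
        _ = _ := by rw [← h]; simp only [mul_assoc])

theorem conjAlgHom_apply (ρ : G →* Module.End ℚ U) (g : G) (x : Module.End ℚ U) :
    conjAlgHom ρ g x = ρ g * x * ρ g⁻¹ := by
  simp [conjAlgHom, AlgHom.ofLinearMap_apply, mul_assoc]

theorem conjAlgHom_map (ρ : G →* Module.End ℚ U) (g n : G) :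
    conjAlgHom ρ g (ρ n) = ρ (g * n * g⁻¹) := by
  rw [conjAlgHom_apply, map_mul, map_mul]

theorem ker_eq_bot_of_commute {ρ : G →* Module.End ℚ U}
    (hρ : ∀ W : Submodule ℚ U, (∀ g, ∀ w ∈ W, ρ g w ∈ W) → W = ⊥ ∨ W = ⊤) {x : Module.End ℚ U}
    (hx : ∀ g, Commute x (ρ g)) (hx0 : x ≠ 0) : LinearMap.ker x = ⊥ := by
  refine (hρ (LinearMap.ker x) ?_).resolve_right fun h => hx0 (LinearMap.ker_eq_top.mp h)
  intro g w hw
  rw [LinearMap.mem_ker] at hw ⊢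
  have := LinearMap.congr_fun (hx g).eq w
  simpa [hw] using this

theorem adjoin_isDomain_of_commute [Nontrivial U] {ρ : G →* Module.End ℚ U}
    (hρ : ∀ W : Submodule ℚ U, (∀ g, ∀ w ∈ W, ρ g w ∈ W) → W = ⊥ ∨ W = ⊤)
    {s : Set (Module.End ℚ U)} (hs : ∀ x ∈ s, ∀ g, Commute x (ρ g)) :
    IsDomain (Algebra.adjoin ℚ s) := by
  have hc : ∀ x ∈ Algebra.adjoin ℚ s, ∀ g, Commute x (ρ g) := by
    intro x hx g
    induction hx using Algebra.adjoin_induction with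
    | mem x hx => exact hs x hx g
    | algebraMap r => exact Algebra.commutes r _
    | add x y _ _ hx hy => exact hx.add_left hy
    | mul x y _ _ hx hy => exact hx.mul_left hy
  have : NoZeroDivisors (Algebra.adjoin ℚ s) := by
    refine ⟨?_⟩
    rintro ⟨x, hx⟩ ⟨y, hy⟩ hxy
    have hxy' : x * y = 0 := congrArg Subtype.val hxy
    by_contra! h
    have hx0 : x ≠ 0 := fun h' => h.1 (Subtype.ext h')
    have hy0 : y ≠ 0 := fun h' => h.2 (Subtype.ext h')
    apply hy0
    ext u
    have h1 : y u ∈ LinearMap.ker x := by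
      rw [LinearMap.mem_ker]; exact LinearMap.congr_fun hxy' u
    rw [ker_eq_bot_of_commute hρ (hc x hx) hx0] at h1
    simpa using h1
  exact NoZeroDivisors.to_isDomain _

theorem adjoin_isMulCommutative {ρ : G →* Module.End ℚ U} {N : Subgroup G}
    (hN : ∀ m ∈ N, ∀ n ∈ N, m * n = n * m) :
    IsMulCommutative (Algebra.adjoin ℚ (ρ '' N)) := by
  refine Algebra.isMulCommutative_adjoin ℚ ?_
  rintro _ ⟨m, hm, rfl⟩ _ ⟨n, hn, rfl⟩
  rw [← map_mul, hN m hm n hn, map_mul]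

/-- A representation is strongly irreducible if subgroups of finite index act irreducibly and
have the same commutant as the whole group. -/
structure IsStronglyIrreducible (ρ : G →* Module.End ℚ U) : Prop where
  eq_bot_or_eq_top : ∀ H : Subgroup G, H.FiniteIndex → ∀ W : Submodule ℚ U,
    (∀ h ∈ H, ∀ w ∈ W, ρ h w ∈ W) → W = ⊥ ∨ W = ⊤
  commute : ∀ H : Subgroup G, H.FiniteIndex → ∀ x : Module.End ℚ U,
    (∀ h ∈ H, Commute x (ρ h)) → ∀ g, Commute x (ρ g)

namespace IsStronglyIrreducible

variable {ρ : G →* Module.End ℚ U}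

theorem ker_eq_bot (hρ : IsStronglyIrreducible ρ) {x : Module.End ℚ U}
    (hx : ∀ g, Commute x (ρ g)) (hx0 : x ≠ 0) : LinearMap.ker x = ⊥ :=
  ker_eq_bot_of_commute
    (fun W hW => hρ.eq_bot_or_eq_top ⊤ inferInstance W fun g _ => hW g) hx hx0

theorem adjoin_isDomain [Nontrivial U] (hρ : IsStronglyIrreducible ρ)
    {s : Set (Module.End ℚ U)} (hs : ∀ x ∈ s, ∀ g, Commute x (ρ g)) :
    IsDomain (Algebra.adjoin ℚ s) :=
  adjoin_isDomain_of_commute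
    (fun W hW => hρ.eq_bot_or_eq_top ⊤ inferInstance W fun g _ => hW g) hs

theorem conjAlgHom_mem_adjoin {N : Subgroup G} [N.Normal] {x : Module.End ℚ U}
    (hx : x ∈ Algebra.adjoin ℚ (ρ '' N)) (g : G) :
    conjAlgHom ρ g x ∈ Algebra.adjoin ℚ (ρ '' N) := by
  have h1 : (Algebra.adjoin ℚ (ρ '' N)).map (conjAlgHom ρ g) ≤ Algebra.adjoin ℚ (ρ '' N) := by
    rw [AlgHom.map_adjoin]
    refine Algebra.adjoin_mono ?_
    rintro _ ⟨_, ⟨n, hn, rfl⟩, rfl⟩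
    rw [conjAlgHom_map]
    exact ⟨_, Subgroup.Normal.conj_mem ‹_› n hn g, rfl⟩
  exact h1 ⟨x, hx, rfl⟩

/-- Conjugation by G preserves the nilradical, so the common kernel of the nilpotents is invariant,
hence zero or everything. It is not zero because the nilradical is nilpotent. -/
theorem adjoin_isReduced [FiniteDimensional ℚ U] [Nontrivial U] (hρ : IsStronglyIrreducible ρ)
    {N : Subgroup G} [N.Normal] [IsMulCommutative (Algebra.adjoin ℚ (ρ '' N))] :
    IsReduced (Algebra.adjoin ℚ (ρ '' N)) := by
  set R := Algebra.adjoin ℚ (ρ '' N)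
  have hArt : IsArtinianRing R := IsArtinianRing.of_finite ℚ R
  let W : Submodule ℚ U := ⨅ x : nilradical R, LinearMap.ker (x.1.1 : Module.End ℚ U)
  have memW : ∀ u, u ∈ W ↔ ∀ x : R, IsNilpotent x → (x : Module.End ℚ U) u = 0 := by
    intro u
    simp only [W, Submodule.mem_iInf, LinearMap.mem_ker, Subtype.forall, mem_nilradical]
  have hW : W = ⊥ ∨ W = ⊤ := by
    refine hρ.eq_bot_or_eq_top ⊤ inferInstance W ?_
    intro g _ u hu
    rw [memW] at hu ⊢
    intro x hx
    have hy : IsNilpotent (⟨conjAlgHom ρ g⁻¹ x, conjAlgHom_mem_adjoin x.2 g⁻¹⟩ : R) := by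
      obtain ⟨k, hk⟩ := hx
      refine ⟨k, Subtype.ext ?_⟩
      have : (x : Module.End ℚ U) ^ k = 0 := congrArg Subtype.val hk
      change (conjAlgHom ρ g⁻¹ x) ^ k = 0
      rw [← map_pow, this, map_zero]
    have h2 := hu _ hy
    have h3 : ρ g * conjAlgHom ρ g⁻¹ x = x * ρ g := by
      rw [conjAlgHom_apply, inv_inv, ← mul_assoc, ← mul_assoc, ← map_mul, mul_inv_cancel, map_one,
        one_mul]
    have h4 := LinearMap.congr_fun h3 u
    simp only [Module.End.mul_apply] at h4
    rw [← h4]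
    exact (congrArg (ρ g) h2).trans (map_zero _)
  rcases hW with hW | hW
  · exfalso
    obtain ⟨k, hk⟩ := IsArtinianRing.isNilpotent_nilradical (R := R)
    obtain ⟨u, hu⟩ := exists_ne (0 : U)
    -- If no nonzero vector is killed by all nilpotents, products of arbitrarily many nilpotents can
    -- be chosen not to kill u.
    have key : ∀ j : ℕ, ∃ y ∈ nilradical R ^ j, (y : Module.End ℚ U) u ≠ 0 := by
      intro j
      induction j with
      | zero => exact ⟨1, by simp, by simpa using hu⟩
      | succ j ih =>
        obtain ⟨y, hy, hyu⟩ := ih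
        have : (y : Module.End ℚ U) u ∉ W := by rw [hW]; simpa using hyu
        rw [memW] at this
        push Not at this
        obtain ⟨x, hx, hxy⟩ := this
        refine ⟨x * y, ?_, hxy⟩
        rw [pow_succ']
        exact Ideal.mul_mem_mul (mem_nilradical.mpr hx) hy
    obtain ⟨y, hy, hyu⟩ := key k
    rw [hk] at hy
    have : y = 0 := by simpa using hy
    exact hyu (by rw [this]; rfl)
  · refine ⟨fun x hx => Subtype.ext (LinearMap.ext fun u => ?_)⟩
    exact (memW u).mp (hW ▸ Submodule.mem_top) x hx

/-- A finite conjugacy class means a centralizer of finite index, and strong irreducibility extends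
commutation from that centralizer to all of G. -/
theorem mem_center_of_finite_conj (hρ : IsStronglyIrreducible ρ) (hinj : Function.Injective ρ)
    {n : G} (hn : (Set.range fun g : G => g * n * g⁻¹).Finite) : n ∈ Subgroup.center G := by
  have hfin : Finite (G ⧸ Subgroup.centralizer ({n} : Set G)) := by
    have := hn.to_subtype
    let F : G ⧸ Subgroup.centralizer ({n} : Set G) → Set.range fun g : G => g * n * g⁻¹ :=
      Quotient.lift (fun g => ⟨g * n * g⁻¹, g, rfl⟩) (by
        intro a b hab
        have hab' : a⁻¹ * b ∈ Subgroup.centralizer ({n} : Set G) :=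
          QuotientGroup.leftRel_apply.mp hab
        rw [Subgroup.mem_centralizer_singleton_iff] at hab'
        refine Subtype.ext ?_
        change a * n * a⁻¹ = b * n * b⁻¹
        calc a * n * a⁻¹ = a * (n * (a⁻¹ * b)) * b⁻¹ := by group
          _ = b * n * b⁻¹ := by rw [← hab']; group)
    refine Finite.of_injective F ?_
    intro a b
    induction a using QuotientGroup.induction_on with | H a => ?_
    induction b using QuotientGroup.induction_on with | H b => ?_
    intro hab
    have hab' : a * n * a⁻¹ = b * n * b⁻¹ := congrArg Subtype.val hab
    rw [QuotientGroup.eq, Subgroup.mem_centralizer_singleton_iff]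
    have : n * (a⁻¹ * b) = (a⁻¹ * b) * n := by
      calc n * (a⁻¹ * b) = a⁻¹ * (a * n * a⁻¹) * b := by group
        _ = _ := by rw [hab']; group
    first | exact this | exact this.symm
  rw [Subgroup.mem_center_iff]
  intro g
  refine hinj ?_
  rw [map_mul, map_mul]
  refine (hρ.commute (Subgroup.centralizer {n}) Subgroup.finiteIndex_of_finite_quotient (ρ n) ?_
    g).eq.symm
  intro h hh
  rw [Subgroup.mem_centralizer_singleton_iff] at hh
  change ρ n * ρ h = ρ h * ρ n
  rw [← map_mul, ← map_mul, hh]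

/-- All conjugates of n are roots of the minimal polynomial of ρ n in the commutative reduced
algebra generated by ρ(N), so there are finitely many. -/
theorem abelian_normal_le_center [FiniteDimensional ℚ U] [Nontrivial U]
    (hρ : IsStronglyIrreducible ρ) (hinj : Function.Injective ρ) (N : Subgroup G) [hNn : N.Normal]
    (hN : ∀ m ∈ N, ∀ n ∈ N, m * n = n * m) : N ≤ Subgroup.center G := by
  intro n hn
  refine hρ.mem_center_of_finite_conj hinj ?_
  have := adjoin_isMulCommutative (ρ := ρ) hN
  have hred := hρ.adjoin_isReduced (N := N)
  set R := Algebra.adjoin ℚ (ρ '' N)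
  have hArt : IsArtinianRing R := IsArtinianRing.of_finite ℚ R
  have hp : minpoly ℚ (ρ n) ≠ 0 := minpoly.ne_zero (Algebra.IsIntegral.isIntegral _)
  have hfin := (finite_setOf_aeval_eq_zero (R := R) hp).image (Subtype.val)
  refine Set.Finite.of_finite_image (f := ρ) (hfin.subset ?_) hinj.injOn
  rintro _ ⟨_, ⟨g, rfl⟩, rfl⟩
  have hmem : ρ (g * n * g⁻¹) ∈ R := Algebra.subset_adjoin ⟨_, hNn.conj_mem n hn g, rfl⟩
  refine ⟨⟨_, hmem⟩, Subtype.ext ?_, rfl⟩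
  have h1 := Polynomial.aeval_algHom_apply R.val ⟨_, hmem⟩ (minpoly ℚ (ρ n))
  refine h1.symm.trans ?_
  change Polynomial.aeval (ρ (g * n * g⁻¹)) (minpoly ℚ (ρ n)) = 0
  rw [← conjAlgHom_map, Polynomial.aeval_algHom_apply, minpoly.aeval, map_zero]

/-- By Schur's lemma the centre generates a domain, that is, a number field, which has finitely many
roots of unity. -/
theorem finite_torsion_center [FiniteDimensional ℚ U] [Nontrivial U]
    (hρ : IsStronglyIrreducible ρ) (hinj : Function.Injective ρ) :
    {z : G | z ∈ Subgroup.center G ∧ IsOfFinOrder z}.Finite := by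
  have hcomm : ∀ m ∈ Subgroup.center G, ∀ n ∈ Subgroup.center G, m * n = n * m :=
    fun m _ n hn => Subgroup.mem_center_iff.mp hn m
  have := adjoin_isMulCommutative (ρ := ρ) hcomm
  have hdom : IsDomain (Algebra.adjoin ℚ (ρ '' (Subgroup.center G : Set G))) := by
    refine hρ.adjoin_isDomain ?_
    rintro _ ⟨z, hz, rfl⟩ g
    change ρ z * ρ g = ρ g * ρ z
    rw [← map_mul, ← map_mul, Subgroup.mem_center_iff.mp hz g]
  set R := Algebra.adjoin ℚ (ρ '' (Subgroup.center G : Set G))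
  refine Set.Finite.of_finite_image (f := ρ)
    (((finite_setOf_isOfFinOrder (R := R)).image Subtype.val).subset ?_) hinj.injOn
  rintro _ ⟨z, ⟨hz, hfin⟩, rfl⟩
  have hmem : ρ z ∈ R := Algebra.subset_adjoin ⟨z, hz, rfl⟩
  refine ⟨⟨_, hmem⟩, ?_, rfl⟩
  obtain ⟨n, hn, hzn⟩ := hfin.exists_pow_eq_one
  refine isOfFinOrder_iff_pow_eq_one.mpr ⟨n, hn, Subtype.ext ?_⟩
  change (ρ z) ^ n = 1
  rw [← map_pow, hzn, map_one]

/-- Every z ^ j * n is conjugate to n, so all are roots of one polynomial in the commutative algebra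
generated by ρ z and ρ n. In a residue field finitely many values are possible, which forces a power
of z to be one there; Schur's lemma lifts this to G. -/
theorem isOfFinOrder_of_conj_eq_mul [FiniteDimensional ℚ U] [Nontrivial U]
    (hρ : IsStronglyIrreducible ρ) (hinj : Function.Injective ρ) {g n z : G}
    (hz : z ∈ Subgroup.center G) (h : g * n * g⁻¹ = z * n) : IsOfFinOrder z := by
  have hzc := Subgroup.mem_center_iff.mp hz
  have hpow : ∀ j : ℕ, g ^ j * n * (g ^ j)⁻¹ = z ^ j * n := by
    intro j
    induction j with
    | zero => simp
    | succ j ih =>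
      calc g ^ (j + 1) * n * (g ^ (j + 1))⁻¹ = g * (g ^ j * n * (g ^ j)⁻¹) * g⁻¹ := by
            rw [pow_succ']; group
        _ = (g * z ^ j) * n * g⁻¹ := by rw [ih]; group
        _ = z ^ j * (g * n * g⁻¹) := by
            rw [Subgroup.mem_center_iff.mp (pow_mem hz j) g]; group
        _ = z ^ (j + 1) * n := by rw [h, pow_succ]; group
  have hcm : IsMulCommutative (Algebra.adjoin ℚ ({ρ z, ρ n} : Set (Module.End ℚ U))) := by
    refine Algebra.isMulCommutative_adjoin ℚ ?_
    have h1 : ρ z * ρ n = ρ n * ρ z := by rw [← map_mul, ← map_mul, hzc n]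
    rintro x (rfl | rfl) y (rfl | rfl)
    · rfl
    · exact h1
    · exact h1.symm
    · rfl
  set R := Algebra.adjoin ℚ ({ρ z, ρ n} : Set (Module.End ℚ U))
  have hArt : IsArtinianRing R := IsArtinianRing.of_finite ℚ R
  let z' : R := ⟨ρ z, Algebra.subset_adjoin (by simp)⟩
  let n' : R := ⟨ρ n, Algebra.subset_adjoin (by simp)⟩
  have hunit : ∀ x : R, LinearMap.ker (x : Module.End ℚ U) = ⊥ → IsUnit x := by
    intro x hx
    refine IsArtinianRing.isUnit_of_mem_nonZeroDivisors (mem_nonZeroDivisors_iff_left.mpr ?_)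
    intro y hxy
    refine Subtype.ext (LinearMap.ext fun u => ?_)
    have h1 : (y : Module.End ℚ U) u ∈ LinearMap.ker (x : Module.End ℚ U) :=
      LinearMap.mem_ker.mpr (LinearMap.congr_fun (congrArg Subtype.val hxy) u)
    rw [hx] at h1
    simpa using h1
  obtain ⟨M, hM⟩ := Ideal.exists_maximal R
  have hp : minpoly ℚ (ρ n) ≠ 0 := minpoly.ne_zero (Algebra.IsIntegral.isIntegral _)
  obtain ⟨i, k, h3⟩ := exists_pow_mul_mem_of_aeval_eq_zero M hp z' n' (by
    intro j
    refine Subtype.ext ?_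
    refine (Polynomial.aeval_algHom_apply R.val (z' ^ j * n') (minpoly ℚ (ρ n))).symm.trans ?_
    have : R.val (z' ^ j * n') = conjAlgHom ρ (g ^ j) (ρ n) := by
      rw [conjAlgHom_map, hpow, map_mul, map_pow, map_mul, map_pow]; rfl
    rw [this, Polynomial.aeval_algHom_apply, minpoly.aeval, map_zero]
    rfl)
  -- The factor z' ^ i * n' comes from a group element, so it is a unit and cancels.
  have h4 : z' ^ (k + 1) - 1 ∈ M := by
    refine (Ideal.unit_mul_mem_iff_mem M (hunit _ ?_)).mp h3
    have : ((z' ^ i * n' : R) : Module.End ℚ U) = ρ (z ^ i * n) := by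
      rw [map_mul, map_pow]; rfl
    rw [this]
    refine LinearMap.ker_eq_bot_of_inverse (g := ρ (z ^ i * n)⁻¹) ?_
    change ρ (z ^ i * n)⁻¹ * ρ (z ^ i * n) = 1
    rw [← map_mul, inv_mul_cancel, map_one]
  refine isOfFinOrder_iff_pow_eq_one.mpr ⟨k + 1, by lia, hinj ?_⟩
  rw [map_pow, map_one]
  by_contra hne
  -- A nonzero operator commuting with the representation is injective, hence a unit of the Artinian
  -- ring, and cannot lie in the maximal ideal M.
  refine hM.ne_top (Ideal.eq_top_of_isUnit_mem M h4 (hunit _ ?_))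
  refine hρ.ker_eq_bot (x := ρ z ^ (k + 1) - 1) (fun y => ?_) (sub_ne_zero.mpr hne)
  refine Commute.sub_left (Commute.pow_left ?_ _) (Commute.one_left _)
  change ρ z * ρ y = ρ y * ρ z
  rw [← map_mul, ← map_mul, hzc y]

/-- A solvable group with a faithful strongly irreducible representation is commutative. -/
theorem center_eq_top [FiniteDimensional ℚ U] [Nontrivial U] (hρ : IsStronglyIrreducible ρ)
    (hinj : Function.Injective ρ) [hs : Group.IsSolvable G] : Subgroup.center G = ⊤ := by
  classical
  obtain ⟨m, hm⟩ := hs.solvable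
  have hex : ∃ k, derivedSeries G k ≤ Subgroup.center G := ⟨m, hm ▸ bot_le⟩
  rcases hk : Nat.find hex with _ | k
  · have := Nat.find_spec hex
    rw [hk, derivedSeries_zero] at this
    exact top_le_iff.mp this
  exfalso
  set Z := Subgroup.center G
  have hZ : ∀ {z : G}, z ∈ Z → ∀ g : G, g * z = z * g := fun hz => Subgroup.mem_center_iff.mp hz
  set N := derivedSeries G k
  have hNn : N.Normal := derivedSeries_normal G k
  have hcN : ⁅N, N⁆ ≤ Z := by
    have := Nat.find_spec hex
    rwa [hk, derivedSeries_succ] at this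
  -- Minimality of k + 1 is contradicted once N is central, and for this each n in N needs only a
  -- finite conjugacy class.
  refine Nat.find_min hex (m := k) (hk ▸ Nat.lt_succ_self k)
      fun n hn => hρ.mem_center_of_finite_conj hinj ?_
  have hcent : N ⊓ Subgroup.centralizer (N : Set G) ≤ Z :=
    hρ.abelian_normal_le_center hinj _ fun a ha b hb =>
      (Subgroup.mem_centralizer_iff.mp hb.2 a ha.1)
  -- Finitely many elements of N whose images span the linear span of ρ(N): commuting with them is
  -- commuting with N.
  obtain ⟨S, hSN, hspan⟩ := (Submodule.fg_span_iff_fg_span_finset_subset (R := ℚ)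
    (ρ '' (N : Set G))).mp (IsNoetherian.noetherian _)
  have htor := hρ.finite_torsion_center hinj
  have hcommS : ∀ x, (∀ s ∈ N, ρ s ∈ S → x * s = s * x) → ∀ s ∈ N, s * x = x * s := by
    intro x hx s hs
    refine hinj ?_
    rw [map_mul, map_mul]
    have h1 : ρ s ∈ Submodule.span ℚ (S : Set (Module.End ℚ U)) :=
      hspan ▸ Submodule.subset_span ⟨s, hs, rfl⟩
    refine Submodule.span_induction (p := fun a _ => a * ρ x = ρ x * a) ?_ ?_ ?_ ?_ h1
    · intro a ha
      obtain ⟨t, ht, rfl⟩ := hSN ha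
      rw [← map_mul, ← map_mul, hx t ht ha]
    · simp
    · intro a b _ _ ha hb; rw [add_mul, mul_add, ha, hb]
    · intro c a _ ha; rw [smul_mul_assoc, mul_smul_comm, ha]
  have hSN' : ∀ s : S, ∃ t ∈ N, ρ t = s := fun s => hSN s.2
  choose t htN ht using hSN'
  have hcomm_mem : ∀ a ∈ N, ∀ b ∈ N, a * b * a⁻¹ * b⁻¹ ∈ Z := fun a ha b hb =>
    hcN (Subgroup.commutator_mem_commutator ha hb)
  -- A conjugate x of n is recorded by its commutators with the chosen elements. These are central
  -- and of finite order, so finitely many records occur. Two conjugates with the same record differ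
  -- by an element of N centralizing N, which is again central and of finite order.
  refine Set.Finite.of_finite_fibers (fun x : G => fun s : S => x * t s * x⁻¹ * (t s)⁻¹) ?_ ?_
  · refine (Set.Finite.pi' fun _ : S => htor).subset ?_
    rintro _ ⟨_, ⟨g, rfl⟩, rfl⟩ s
    have hx := hNn.conj_mem n hn g
    have h1 := hcomm_mem _ hx _ (htN s)
    exact ⟨h1, hρ.isOfFinOrder_of_conj_eq_mul hinj (g := g * n * g⁻¹) (n := t s) h1 (by group)⟩
  · rintro _ ⟨_, ⟨g, rfl⟩, rfl⟩
    refine ((htor.image fun z => (g * n * g⁻¹) * z)).subset ?_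
    rintro _ ⟨⟨h, rfl⟩, hfib⟩
    have hx := hNn.conj_mem n hn g
    have hy := hNn.conj_mem n hn h
    have hfib' : ∀ s : S, h * n * h⁻¹ * t s * (h * n * h⁻¹)⁻¹ * (t s)⁻¹ =
      g * n * g⁻¹ * t s * (g * n * g⁻¹)⁻¹ * (t s)⁻¹ := fun s => congrFun hfib s
    refine ⟨(g * n * g⁻¹)⁻¹ * (h * n * h⁻¹), ?_, by group⟩
    have hz : (g * n * g⁻¹)⁻¹ * (h * n * h⁻¹) ∈ Z := by
      refine hcent ⟨N.mul_mem (N.inv_mem hx) hy, Subgroup.mem_centralizer_iff.mpr ?_⟩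
      refine hcommS _ ?_
      intro s hs hsS
      have hts : t ⟨_, hsS⟩ = s := hinj (ht ⟨_, hsS⟩)
      have h1 := mul_right_cancel (hfib' ⟨_, hsS⟩)
      rw [hts] at h1
      generalize g * n * g⁻¹ = a at *
      generalize h * n * h⁻¹ = b at *
      calc a⁻¹ * b * s = a⁻¹ * (b * s * b⁻¹) * b := by group
        _ = s * (a⁻¹ * b) := by rw [h1]; group
    refine ⟨hz, hρ.isOfFinOrder_of_conj_eq_mul hinj (g := g⁻¹ * h) (n := n) hz ?_⟩
    rw [← hZ hz]
    have e1 : (g⁻¹ * h) * n * (g⁻¹ * h)⁻¹ = g⁻¹ * ((g * n * g⁻¹) *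
      ((g * n * g⁻¹)⁻¹ * (h * n * h⁻¹))) * g := by group
    rw [e1, hZ hz, mul_assoc g⁻¹, mul_assoc, ← mul_assoc g⁻¹, hZ hz g⁻¹, hZ hz n]
    group

end IsStronglyIrreducible

end StronglyIrreducible

/-! ### Solvable groups: an element without virtually fixed vectors -/

section SolvableRepresentation

open scoped IsMulCommutative Pointwise

variable {G : Type*} [Group G] {U : Type*} [AddCommGroup U] [Module ℚ U]

/-- The image group is solvable and its tautological representation is faithful and still strongly
irreducible. -/
theorem IsStronglyIrreducible.commute_of_isSolvable [FiniteDimensional ℚ U] [Nontrivial U]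
    {ρ : G →* Module.End ℚ U} (hρ : IsStronglyIrreducible ρ) [Group.IsSolvable G] :
    (∀ a b, Commute (ρ a) (ρ b)) ∧ {x | x ∈ Set.range ρ ∧ IsOfFinOrder x}.Finite := by
  let f : G →* (Module.End ℚ U)ˣ := ρ.toHomUnits
  let ρ' : f.range →* Module.End ℚ U := (Units.coeHom _).comp f.range.subtype
  have hf : ∀ g, ρ' (f.rangeRestrict g) = ρ g := fun g => rfl
  have hinj : Function.Injective ρ' := Units.val_injective.comp Subtype.val_injective
  have hsurj := f.rangeRestrict_surjective
  have hcomap : ∀ H : Subgroup f.range, H.FiniteIndex → (H.comap f.rangeRestrict).FiniteIndex :=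
    fun H hH => ⟨by rw [Subgroup.index_comap_of_surjective H hsurj]; exact hH.index_ne_zero⟩
  have hρ' : IsStronglyIrreducible ρ' := by
    constructor
    · intro H hH W hW
      exact hρ.eq_bot_or_eq_top (H.comap f.rangeRestrict)
        (hcomap H hH) W
        fun h hh w hw => hW (f.rangeRestrict h) hh w hw
    · intro H hH x hx g
      obtain ⟨g, rfl⟩ := hsurj g
      exact hρ.commute (H.comap f.rangeRestrict)
        (hcomap H hH) x
        (fun h hh => hx (f.rangeRestrict h) hh) g
  have : Group.IsSolvable f.range := Group.isSolvable_of_surjective hsurj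
  have hcen := hρ'.center_eq_top hinj
  refine ⟨fun a b => ?_, ?_⟩
  · have h1 : f.rangeRestrict b ∈ Subgroup.center f.range := hcen ▸ Subgroup.mem_top _
    have h2 := congrArg ρ' (Subgroup.mem_center_iff.mp h1 (f.rangeRestrict a))
    rwa [map_mul, map_mul] at h2
  · refine ((hρ'.finite_torsion_center hinj).image ρ').subset ?_
    rintro _ ⟨⟨g, rfl⟩, hg⟩
    refine ⟨f.rangeRestrict g, ⟨hcen ▸ Subgroup.mem_top _, ?_⟩, rfl⟩
    obtain ⟨n, hn, h⟩ := hg.exists_pow_eq_one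
    refine isOfFinOrder_iff_pow_eq_one.mpr ⟨n, hn, hinj ?_⟩
    rw [map_pow, map_one]
    exact h

/-- As the image is commutative, the elements acting with finite order form a subgroup H. If H has
finite index, its image is finite and the kernel of H acts trivially. Outside H every ρ g ^ k - 1
with k ≠ 0 is nonzero, hence injective by Schur's lemma. -/
theorem IsStronglyIrreducible.trivial_or_exists_infinite_index [FiniteDimensional ℚ U]
    [Nontrivial U] {ρ : G →* Module.End ℚ U} (hρ : IsStronglyIrreducible ρ)
    [Group.IsSolvable G] :
    (∃ D : Subgroup G, D.FiniteIndex ∧ ∀ g ∈ D, ρ g = 1) ∨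
      ∃ H : Subgroup G, ¬ H.FiniteIndex ∧
        ∀ g, g ∉ H → ∀ k : ℕ, k ≠ 0 → ∀ u, ρ (g ^ k) u = u → u = 0 := by
  obtain ⟨hcomm, hfin⟩ := hρ.commute_of_isSolvable
  let H : Subgroup G :=
    { carrier := {g | IsOfFinOrder (ρ g)}
      one_mem' := by simp
      mul_mem' := by
        intro a b ha hb
        change IsOfFinOrder (ρ (a * b))
        rw [map_mul]
        exact (hcomm a b).isOfFinOrder_mul ha hb
      inv_mem' := by
        intro a ha
        obtain ⟨n, hn, h⟩ := (show IsOfFinOrder (ρ a) from ha).exists_pow_eq_one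
        refine isOfFinOrder_iff_pow_eq_one.mpr ⟨n, hn, ?_⟩
        have h1 : ρ a⁻¹ ^ n * ρ a ^ n = 1 := by
          rw [← map_pow, ← map_pow, ← map_mul, inv_pow, inv_mul_cancel, map_one]
        rwa [h, mul_one] at h1 }
  by_cases hH : H.FiniteIndex
  · left
    let f : H →* (Module.End ℚ U)ˣ := ρ.toHomUnits.comp H.subtype
    have hfr : Finite f.range := by
      refine Set.Finite.to_subtype (Set.Finite.of_finite_image (f := Units.val) ?_
        Units.val_injective.injOn)
      refine hfin.subset ?_
      rintro _ ⟨_, ⟨h, rfl⟩, rfl⟩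
      exact ⟨⟨h, rfl⟩, h.2⟩
    refine ⟨f.ker.map H.subtype, ?_, ?_⟩
    · refine ⟨?_⟩
      rw [Subgroup.index_map_subtype]
      exact mul_ne_zero (Subgroup.finiteIndex_ker f).index_ne_zero hH.index_ne_zero
    · rintro _ ⟨g, hg, rfl⟩
      exact congrArg Units.val (MonoidHom.mem_ker.mp hg)
  · right
    refine ⟨H, hH, fun g hg k hk u hu => ?_⟩
    by_contra hu0
    have hne : ρ g ^ k - 1 ≠ 0 := fun h => hg
      (isOfFinOrder_iff_pow_eq_one.mpr ⟨k, Nat.pos_of_ne_zero hk, sub_eq_zero.mp h⟩)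
    have hker := hρ.ker_eq_bot (x := ρ g ^ k - 1)
      (fun y => ((hcomm g y).pow_left k).sub_left (Commute.one_left _)) hne
    have : u ∈ LinearMap.ker (ρ g ^ k - 1) := by
      rw [LinearMap.mem_ker, ← map_pow, LinearMap.sub_apply, hu, Module.End.one_apply, sub_self]
    rw [hker] at this
    exact hu0 this

/-- The restriction of a representation to a subgroup and a subspace stable under it. -/
def restrictRep (ρ : G →* Module.End ℚ U) (D : Subgroup G) (W : Submodule ℚ U)
    (h : ∀ g ∈ D, ∀ w ∈ W, ρ g w ∈ W) : D →* Module.End ℚ W where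
  toFun g := (ρ g).restrict (h g g.2)
  map_one' := by ext; simp
  map_mul' a b := by ext; simp

/-- The quotient of the restriction of a representation to a subgroup. -/
def quotientRep (ρ : G →* Module.End ℚ U) (D : Subgroup G) (W : Submodule ℚ U)
    (h : ∀ g ∈ D, ∀ w ∈ W, ρ g w ∈ W) : D →* Module.End ℚ (U ⧸ W) where
  toFun g := W.mapQ W (ρ g) (h g g.2)
  map_one' := by ext; simp
  map_mul' a b := by ext; simp

theorem Subgroup.FiniteIndex.map_subtype {D : Subgroup G} (hD : D.FiniteIndex) {K : Subgroup D}
    (hK : K.FiniteIndex) : (K.map D.subtype).FiniteIndex :=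
  ⟨by rw [Subgroup.index_map_subtype]; exact mul_ne_zero hK.index_ne_zero hD.index_ne_zero⟩

theorem Subgroup.FiniteIndex.of_map_subtype {D : Subgroup G} {K : Subgroup D}
    (hK : (K.map D.subtype).FiniteIndex) : K.FiniteIndex :=
  ⟨by have := hK.index_ne_zero; rw [Subgroup.index_map_subtype] at this
      exact left_ne_zero_of_mul this⟩

/-- Two successive minimizations: first the dimension of a nonzero virtually invariant W, then the
dimension of the span of ρ(D) over finite-index D. After the second, every smaller finite-index
subgroup has the same span, and commutation is a linear condition on that span. -/
theorem exists_isStronglyIrreducible_restrictRep [FiniteDimensional ℚ U] [Nontrivial U]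
    (ρ : G →* Module.End ℚ U) :
    ∃ (D : Subgroup G) (_ : D.FiniteIndex) (W : Submodule ℚ U) (_ : W ≠ ⊥)
      (h : ∀ g ∈ D, ∀ w ∈ W, ρ g w ∈ W), IsStronglyIrreducible (restrictRep ρ D W h) := by
  classical
  have hex : ∃ n : ℕ, ∃ D : Subgroup G, D.FiniteIndex ∧ ∃ W : Submodule ℚ U, W ≠ ⊥ ∧
      (∀ g ∈ D, ∀ w ∈ W, ρ g w ∈ W) ∧ Module.finrank ℚ W = n :=
    ⟨_, ⊤, inferInstance, ⊤, top_ne_bot, fun _ _ _ _ => Submodule.mem_top, rfl⟩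
  obtain ⟨D₀, hD₀, W, hW, hst, hrank⟩ := Nat.find_spec hex
  have hmin : ∀ D : Subgroup G, D.FiniteIndex → ∀ W' : Submodule ℚ U, W' ≤ W → W' ≠ ⊥ →
      (∀ g ∈ D, ∀ w ∈ W', ρ g w ∈ W') → W' = W := by
    intro D hD W' hle hne hst'
    refine Submodule.eq_of_le_of_finrank_le hle ?_
    rw [hrank]
    exact Nat.find_min' hex ⟨D, hD, W', hne, hst', rfl⟩
  have hex' : ∃ n : ℕ, ∃ D : Subgroup G, D.FiniteIndex ∧ D ≤ D₀ ∧
      Module.finrank ℚ (Submodule.span ℚ (ρ '' D)) = n := ⟨_, D₀, hD₀, le_rfl, rfl⟩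
  obtain ⟨D, hD, hDle, hspan⟩ := Nat.find_spec hex'
  have hmin' : ∀ D' : Subgroup G, D'.FiniteIndex → D' ≤ D →
      Submodule.span ℚ (ρ '' (D' : Set G)) = Submodule.span ℚ (ρ '' D) := by
    intro D' hD' hle
    refine Submodule.eq_of_le_of_finrank_le (Submodule.span_mono (Set.image_mono hle)) ?_
    rw [hspan]
    exact Nat.find_min' hex' ⟨D', hD', hle.trans hDle, rfl⟩
  refine ⟨D, hD, W, hW, fun g hg => hst g (hDle hg), ?_, ?_⟩
  · intro H hH W' hW'
    by_cases hbot : W' = ⊥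
    · exact Or.inl hbot
    right
    have h1 := hmin _ (hD.map_subtype hH) (W'.map W.subtype) (Submodule.map_subtype_le W W')
      (fun h => hbot (Submodule.map_injective_of_injective W.injective_subtype
        (by rw [h, Submodule.map_bot]))) (by
        rintro _ ⟨g, hg, rfl⟩ _ ⟨w, hw, rfl⟩
        exact ⟨_, hW' g hg w hw, rfl⟩)
    have h2 : W'.map W.subtype = (⊤ : Submodule ℚ W).map W.subtype := by
      rw [h1, Submodule.map_top, Submodule.range_subtype]
    exact Submodule.map_injective_of_injective W.injective_subtype h2
  · intro H hH x hx g
    have h1 : ρ g ∈ Submodule.span ℚ (ρ '' (H.map D.subtype : Subgroup G)) := by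
      rw [hmin' _ (hD.map_subtype hH) (Subgroup.map_subtype_le H)]
      exact Submodule.subset_span ⟨g, g.2, rfl⟩
    -- The span lives in the endomorphisms of U while x acts only on W, so stability of W must be
    -- carried through the induction together with commutation.
    have h2 : ∀ u : W, ∃ h : ρ g u ∈ W, (x ⟨ρ g u, h⟩ : U) = ρ g (x u) := by
      refine Submodule.span_induction
        (p := fun a _ => ∀ u : W, ∃ h : a u ∈ W, (x ⟨a u, h⟩ : U) = a (x u)) ?_ ?_ ?_ ?_ h1
      · rintro _ ⟨_, ⟨d, hd, rfl⟩, rfl⟩ u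
        exact ⟨hst d (hDle d.2) u u.2,
          congrArg Subtype.val (LinearMap.congr_fun (hx d hd).eq u)⟩
      · exact fun u => ⟨W.zero_mem, congrArg Subtype.val (map_zero x)⟩
      · intro a b _ _ ha hb u
        obtain ⟨h3, h4⟩ := ha u
        obtain ⟨h5, h6⟩ := hb u
        refine ⟨W.add_mem h3 h5, ?_⟩
        refine Eq.trans ?_ (congrArg₂ (· + ·) h4 h6)
        exact congrArg Subtype.val (map_add x ⟨a u, h3⟩ ⟨b u, h5⟩)
      · intro c a _ ha u
        obtain ⟨h3, h4⟩ := ha u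
        refine ⟨W.smul_mem c h3, ?_⟩
        refine Eq.trans ?_ (congrArg (c • ·) h4)
        exact congrArg Subtype.val (map_smul x c ⟨a u, h3⟩)
    refine LinearMap.ext fun u => Subtype.ext ?_
    exact (h2 u).2

/-- A solvable group acting on a nonzero finite-dimensional rational space either virtually fixes
a nonzero vector, or there are a nonzero virtually invariant subspace and a subgroup of infinite
index outside which no power of an element fixes a nonzero vector of this subspace. -/
theorem exists_virtually_fixed_or_exists_infinite_index [FiniteDimensional ℚ U] [Nontrivial U]
    [Group.IsSolvable G] (ρ : G →* Module.End ℚ U) :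
    (∃ D : Subgroup G, D.FiniteIndex ∧ ∃ v ≠ 0, ∀ g ∈ D, ρ g v = v) ∨
      ∃ D : Subgroup G, D.FiniteIndex ∧ ∃ W : Submodule ℚ U, W ≠ ⊥ ∧
        (∀ g ∈ D, ∀ w ∈ W, ρ g w ∈ W) ∧ ∃ H : Subgroup G, ¬ H.FiniteIndex ∧
          ∀ g ∈ D, g ∉ H → ∀ k : ℕ, k ≠ 0 → ∀ w ∈ W, ρ (g ^ k) w = w → w = 0 := by
  obtain ⟨D, hD, W, hW, hst, hsi⟩ := exists_isStronglyIrreducible_restrictRep ρ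
  have : Nontrivial W := Submodule.nontrivial_iff_ne_bot.mpr hW
  rcases hsi.trivial_or_exists_infinite_index with ⟨K, hK, hfix⟩ | ⟨H, hH, hfix⟩
  · left
    obtain ⟨w, hw⟩ := exists_ne (0 : W)
    refine ⟨_, hD.map_subtype hK, w, fun h => hw (Subtype.ext h), ?_⟩
    rintro _ ⟨g, hg, rfl⟩
    exact congrArg Subtype.val (LinearMap.congr_fun (hfix g hg) w)
  · right
    refine ⟨D, hD, W, hW, hst, H.map D.subtype, fun h => hH h.of_map_subtype, ?_⟩
    intro g hg hgH k hk w hw h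
    have := hfix ⟨g, hg⟩ (fun h' => hgH ⟨_, h', rfl⟩) k hk ⟨w, hw⟩ (Subtype.ext h)
    exact congrArg Subtype.val this

/-- B. H. Neumann's lemma: if finitely many cosets cover a group, one of the subgroups has finite
index. -/
theorem exists_mem_forall_notMem_of_not_finiteIndex {D : Subgroup G} (hD : D.FiniteIndex)
    (s : Finset (Subgroup G)) (hs : ∀ H ∈ s, ¬ H.FiniteIndex) : ∃ g ∈ D, ∀ H ∈ s, g ∉ H := by
  by_contra! h
  have hcov : ⋃ H ∈ s, (1 : D) • ((H.subgroupOf D : Subgroup D) : Set D) = Set.univ := by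
    refine Set.eq_univ_of_forall fun g => ?_
    obtain ⟨H, hH, hg⟩ := h g g.2
    simp only [Set.mem_iUnion, one_smul]
    exact ⟨H, hH, hg⟩
  obtain ⟨H, hH, hfi⟩ := Subgroup.exists_finiteIndex_of_leftCoset_cover hcov
  refine hs H hH ?_
  have h1 := hD.map_subtype hfi
  exact Subgroup.finiteIndex_of_le (H := (H.subgroupOf D).map D.subtype) (by
    rintro _ ⟨g, hg, rfl⟩; exact hg)

/-- The hypothesis excludes virtually fixed vectors in U ⧸ W, so the dichotomy always yields a
larger virtually invariant subspace and one more infinite-index subgroup to avoid. By induction from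
W = ⊤ down to W = ⊥ only finitely many subgroups accumulate. -/
theorem exists_forall_pow_fixed_eq_zero [FiniteDimensional ℚ U] [hs : Group.IsSolvable G]
    (ρ : G →* Module.End ℚ U)
    (h : ∀ (W : Submodule ℚ U) (D : Subgroup G), D.FiniteIndex →
      (∀ g ∈ D, ∀ w ∈ W, ρ g w ∈ W) → ∀ v, (∀ g ∈ D, ρ g v - v ∈ W) → v ∈ W) :
    ∃ g : G, ∀ k : ℕ, k ≠ 0 → ∀ v, ρ (g ^ k) v = v → v = 0 := by
  classical
  have key : ∀ W : Submodule ℚ U, (∃ D : Subgroup G, D.FiniteIndex ∧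
      ∀ g ∈ D, ∀ w ∈ W, ρ g w ∈ W) → ∃ D : Subgroup G, D.FiniteIndex ∧
      ∃ s : Finset (Subgroup G), (∀ H ∈ s, ¬ H.FiniteIndex) ∧ ∀ g ∈ D, (∀ H ∈ s, g ∉ H) →
        ∀ k : ℕ, k ≠ 0 → ∀ v, ρ (g ^ k) v - v ∈ W → v ∈ W := by
    intro W
    induction W using WellFoundedGT.induction with
    | ind W ih =>
    rintro ⟨D, hD, hst⟩
    by_cases htop : W = ⊤
    · exact ⟨⊤, inferInstance, ∅, by simp, fun _ _ _ _ _ v _ => htop ▸ Submodule.mem_top⟩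
    have : Nontrivial (U ⧸ W) := Submodule.Quotient.nontrivial_iff.mpr htop
    rcases exists_virtually_fixed_or_exists_infinite_index (quotientRep ρ D W hst) with
      ⟨K, hK, v, hv, hfix⟩ | ⟨K, hK, Q, hQ, hQst, H, hH, hfix⟩
    · exfalso
      obtain ⟨v, rfl⟩ := Submodule.Quotient.mk_surjective W v
      refine hv ((Submodule.Quotient.mk_eq_zero W).mpr (h W _ (hD.map_subtype hK) ?_ v ?_))
      · rintro _ ⟨g, hg, rfl⟩ w hw
        exact hst g g.2 w hw
      · rintro _ ⟨g, hg, rfl⟩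
        exact (Submodule.Quotient.eq W).mp (hfix g hg)
    · have hWlt : W < Q.comap W.mkQ := by
        refine lt_of_le_of_ne (Submodule.le_comap_mkQ W Q) ?_
        intro heq
        refine hQ ?_
        rw [← Submodule.map_comap_eq_of_surjective W.mkQ_surjective Q, ← heq,
          Submodule.mkQ_map_self]
      obtain ⟨D', hD', s, hs1, hs2⟩ := ih _ hWlt ⟨_, hD.map_subtype hK, by
        rintro _ ⟨g, hg, rfl⟩ w hw
        exact hQst g hg _ hw⟩
      have hDK := hD.map_subtype hK
      refine ⟨D' ⊓ K.map D.subtype, inferInstance, insert (H.map D.subtype) s, ?_, ?_⟩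
      · intro H' hH'
        rcases Finset.mem_insert.mp hH' with rfl | hH'
        · exact fun hfi => hH hfi.of_map_subtype
        · exact hs1 H' hH'
      · rintro _ ⟨hgD', ⟨g, hgK, rfl⟩⟩ hgs k hk v hv
        have hvQ := hs2 _ hgD' (fun H' hH' => hgs H' (Finset.mem_insert_of_mem hH')) k hk v
          (hWlt.le hv)
        have h0 := hfix g hgK (fun h' => hgs _ (Finset.mem_insert_self _ _) ⟨g, h', rfl⟩) k hk
          (Submodule.Quotient.mk v) hvQ ((Submodule.Quotient.eq W).mpr hv)
        exact (Submodule.Quotient.mk_eq_zero W).mp h0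
  obtain ⟨D, hD, s, hs1, hs2⟩ := key ⊥ ⟨⊤, inferInstance, by simp⟩
  obtain ⟨g, hgD, hgs⟩ := exists_mem_forall_notMem_of_not_finiteIndex hD s hs1
  refine ⟨g, fun k hk v hv => ?_⟩
  simpa using hs2 g hgD hgs k hk v (by rw [hv, sub_self]; exact Submodule.zero_mem _)

end SolvableRepresentation

/-! ### Sums of widely separated powers -/

/-- After replacing x by its inverse if necessary, v x > 1, and the nonzero term with the largest
exponent outweighs all the others together. -/
theorem AbsoluteValue.exists_forall_sum_zpow_mul_ne_zero {K κ : Type*} [Field K] [Fintype κ]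
    (v : AbsoluteValue K ℝ) {x : K} (hx0 : x ≠ 0) (hx : v x ≠ 1) {a : κ → K} (ha : ∃ i, a i ≠ 0) :
    ∃ M : ℤ, ∀ n : κ → ℤ, (∀ i j, i ≠ j → M ≤ |n i - n j|) → ∑ i, x ^ n i * a i ≠ 0 := by
  classical
  wlog hlt : 1 < v x generalizing x
  · obtain ⟨M, hM⟩ := this (x := x⁻¹) (inv_ne_zero hx0) (by simpa using hx) (by
      rw [map_inv₀]
      exact (one_lt_inv₀ (v.pos hx0)).mpr (lt_of_le_of_ne (not_lt.mp hlt) hx))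
    refine ⟨M, fun n hn => ?_⟩
    have := hM (fun i => - n i) (fun i j hij => by
      rw [neg_sub_neg, abs_sub_comm]; exact hn i j hij)
    simpa using this
  let S : Finset κ := Finset.univ.filter fun i => a i ≠ 0
  have hS : S.Nonempty := by obtain ⟨i, hi⟩ := ha; exact ⟨i, by simp [S, hi]⟩
  obtain ⟨d, hdS, hd⟩ := S.exists_min_image (fun i => v (a i)) hS
  have hdpos : 0 < v (a d) := v.pos (by simpa [S] using hdS)
  -- A gap M makes the dominant term, at least v x ^ n m * v (a d), exceed the bound v x ^ (n m - M)
  -- * ∑ v (a i) on the rest.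
  obtain ⟨M, hM⟩ := pow_unbounded_of_one_lt ((∑ i, v (a i)) / v (a d)) hlt
  refine ⟨M, fun n hn hsum => ?_⟩
  obtain ⟨m, hmS, hm⟩ := S.exists_max_image n hS
  have hvx : 0 < v x := v.pos hx0
  have hsum' : x ^ n m * a m = - ∑ i ∈ Finset.univ.erase m, x ^ n i * a i := by
    rw [eq_neg_iff_add_eq_zero,
      Finset.add_sum_erase _ (fun i => x ^ n i * a i) (Finset.mem_univ m), hsum]
  have h1 : v x ^ n m * v (a d) ≤ v x ^ n m * v (a m) := by gcongr; exact hd m hmS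
  have h2 : v x ^ n m * v (a m) ≤ ∑ i ∈ Finset.univ.erase m, v x ^ n i * v (a i) := by
    rw [← map_zpow₀, ← map_mul, hsum', v.map_neg]
    refine (v.sum_le _ _).trans (le_of_eq ?_)
    simp
  have h3 : ∑ i ∈ Finset.univ.erase m, v x ^ n i * v (a i) ≤
      ∑ i ∈ Finset.univ.erase m, v x ^ (n m - M) * v (a i) := by
    refine Finset.sum_le_sum fun i hi => ?_
    by_cases hai : a i = 0
    · simp [hai]
    have hle := hm i (by simp [S, hai])
    have h4 := hn i m (Finset.ne_of_mem_erase hi)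
    rw [abs_of_nonpos (by lia)] at h4
    gcongr
    · exact hlt.le
    · lia
  have h5 : ∑ i ∈ Finset.univ.erase m, v x ^ (n m - M) * v (a i) ≤
      v x ^ (n m - M) * ∑ i, v (a i) := by
    rw [← Finset.mul_sum]
    refine mul_le_mul_of_nonneg_left ?_ (zpow_nonneg hvx.le _)
    exact Finset.sum_le_sum_of_subset_of_nonneg (Finset.erase_subset _ _)
      fun i _ _ => v.nonneg _
  have h6 := h1.trans (h2.trans (h3.trans h5))
  rw [show n m = (n m - M) + M by ring, zpow_add₀ hvx.ne', add_sub_cancel_right, mul_assoc,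
    mul_le_mul_iff_right₀ (zpow_pos hvx _), zpow_natCast] at h6
  rw [div_lt_iff₀ hdpos] at hM
  exact absurd h6 (not_le.mpr hM)

/-- If all finite places gave one, x would be an algebraic integer; if all archimedean ones did too,
Kronecker's theorem would make it a root of unity. -/
theorem NumberField.exists_absoluteValue_ne_one {K : Type*} [Field K] [NumberField K] {x : K}
    (hx : ∀ k : ℕ, k ≠ 0 → x ^ k ≠ 1) : ∃ v : AbsoluteValue K ℝ, v x ≠ 1 := by
  by_contra! h
  have hint : x ∈ (algebraMap (NumberField.RingOfIntegers K) K).range := by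
    refine IsDedekindDomain.HeightOneSpectrum.mem_integers_of_valuation_le_one K x fun v => ?_
    by_contra! hv
    refine absurd (h (NumberField.HeightOneSpectrum.adicAbv K v)) (ne_of_gt ?_)
    rw [NumberField.HeightOneSpectrum.adicAbv_def]
    have := WithZeroMulInt.toNNReal_strictMono
        (NumberField.HeightOneSpectrum.one_lt_absNorm_nnreal v) hv
    rw [map_one] at this
    exact_mod_cast this
  obtain ⟨y, rfl⟩ := hint
  obtain ⟨k, hk, hk1⟩ := NumberField.Embeddings.pow_eq_one_of_norm_eq_one K ℂ
    (x := algebraMap (NumberField.RingOfIntegers K) K y)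
    (NumberField.RingOfIntegers.isIntegral_coe y) fun φ => h (NumberField.place φ)
  exact hx k hk.ne' hk1

section CommGroupRepresentation

open scoped IsMulCommutative

variable {G : Type*} [CommGroup G]

/-- The operators generate a number field R and U is a line over it, spanned by `u i₀`. Writing
every `u i` as a multiple of `u i₀` turns the sum into one in R. -/
theorem exists_forall_sum_zpow_ne_zero_of_irreducible {κ U : Type*} [Fintype κ] [AddCommGroup U]
    [Module ℚ U] [FiniteDimensional ℚ U] (ρ : G →* Module.End ℚ U)
    (hρ : ∀ W : Submodule ℚ U, (∀ g, ∀ w ∈ W, ρ g w ∈ W) → W = ⊥ ∨ W = ⊤) {g : G}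
    (hg : ∀ k : ℕ, k ≠ 0 → ∀ v, ρ (g ^ k) v = v → v = 0) {u : κ → U} (hu : ∃ i, u i ≠ 0) :
    ∃ M : ℤ, ∀ n : κ → ℤ, (∀ i j, i ≠ j → M ≤ |n i - n j|) → ∑ i, ρ (g ^ n i) (u i) ≠ 0 := by
  obtain ⟨i₀, hi₀⟩ := hu
  have : Nontrivial U := ⟨⟨u i₀, 0, hi₀⟩⟩
  have := adjoin_isMulCommutative (ρ := ρ) (N := ⊤) fun m _ n _ => mul_comm m n
  have hdom : IsDomain (Algebra.adjoin ℚ (ρ '' (⊤ : Subgroup G))) := by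
    refine adjoin_isDomain_of_commute hρ ?_
    rintro _ ⟨a, -, rfl⟩ b
    change ρ a * ρ b = ρ b * ρ a
    rw [← map_mul, ← map_mul, mul_comm]
  set R := Algebra.adjoin ℚ (ρ '' (⊤ : Subgroup G))
  have hmem : ∀ a, ρ a ∈ R := fun a => Algebra.subset_adjoin ⟨a, trivial, rfl⟩
  let _ : Field R := fieldOfFiniteDimensional ℚ R
  have : CharZero R := algebraRat.charZero R
  have : NumberField R := by
    have h : FiniteDimensional ℚ R := inferInstance
    refine { to_finiteDimensional := ?_ }
    convert! h
    exact Subsingleton.elim _ _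
  let x : R := ⟨ρ g, hmem g⟩
  have hxpow : ∀ k : ℕ, ((x ^ k : R) : Module.End ℚ U) = ρ (g ^ k) := fun k => by
    rw [map_pow]; rfl
  have hx0 : x ≠ 0 := by
    intro h
    have h1 : ρ g = 0 := congrArg Subtype.val h
    have h2 : ρ g⁻¹ * ρ g = 1 := by rw [← map_mul, inv_mul_cancel, map_one]
    rw [h1, mul_zero] at h2
    exact zero_ne_one h2
  obtain ⟨v, hv⟩ := NumberField.exists_absoluteValue_ne_one (x := x) (by
    intro k hk h
    refine hi₀ (hg k hk _ ?_)
    rw [← hxpow, h]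
    rfl)
  have hrep : ∀ w : U, ∃ a : R, (a : Module.End ℚ U) (u i₀) = w := by
    let W : Submodule ℚ U :=
      LinearMap.range ((LinearMap.applyₗ (u i₀)).comp (Subalgebra.toSubmodule R).subtype)
    have hW : W = ⊤ := by
      refine (hρ W ?_).resolve_left ?_
      · rintro h _ ⟨a, rfl⟩
        exact ⟨⟨ρ h * a, R.mul_mem (hmem h) a.2⟩, rfl⟩
      · intro h
        refine hi₀ ((Submodule.eq_bot_iff W).mp h _ ⟨⟨1, R.one_mem⟩, rfl⟩)
    intro w
    obtain ⟨a, ha⟩ : w ∈ W := hW ▸ Submodule.mem_top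
    exact ⟨a, ha⟩
  choose a ha using fun i => hrep (u i)
  obtain ⟨M, hM⟩ := v.exists_forall_sum_zpow_mul_ne_zero hx0 hv (a := a)
    ⟨i₀, fun h => hi₀ (by rw [← ha i₀, h]; rfl)⟩
  have hxz : ∀ k : ℤ, ((x ^ k : R) : Module.End ℚ U) = ρ (g ^ k) := by
    intro k
    rcases k with k | k
    · simpa using hxpow k
    · have h1 : (x ^ (Int.negSucc k)) * x ^ (k + 1) = 1 := by
        rw [zpow_negSucc, inv_mul_cancel₀ (pow_ne_zero _ hx0)]
      have h2 : ((x ^ (Int.negSucc k) : R) : Module.End ℚ U) * ρ (g ^ (k + 1)) = 1 := by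
        rw [← hxpow]; exact congrArg Subtype.val h1
      have h3 : ρ (g ^ (k + 1)) * ρ (g ^ (Int.negSucc k)) = 1 := by
        rw [← map_mul, zpow_negSucc, mul_inv_cancel, map_one]
      calc ((x ^ (Int.negSucc k) : R) : Module.End ℚ U)
          = (x ^ (Int.negSucc k) : R) * (ρ (g ^ (k + 1)) * ρ (g ^ (Int.negSucc k))) := by
            rw [h3, mul_one]
        _ = _ := by rw [← mul_assoc, h2, one_mul]
  refine ⟨M, fun n hn hsum => hM n hn ?_⟩
  have h1 : ((∑ i, x ^ n i * a i : R) : Module.End ℚ U) (u i₀) = 0 := by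
    rw [← hsum, AddSubmonoidClass.coe_finsetSum, LinearMap.sum_apply]
    refine Finset.sum_congr rfl fun i _ => ?_
    rw [← ha i, ← hxz]
    rfl
  by_contra hne
  refine hi₀ ?_
  have h2 : ((∑ i, x ^ n i * a i)⁻¹ : R) * (∑ i, x ^ n i * a i) = 1 := inv_mul_cancel₀ hne
  have h3 := LinearMap.congr_fun (congrArg Subtype.val h2) (u i₀)
  refine h3.symm.trans ((congrArg ⇑((∑ i, x ^ n i * a i)⁻¹ : R).1 h1).trans ?_)
  exact LinearMap.map_zero _

/-- Induction on dimension: with an invariant W, either all vectors lie in W or the sum is already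
nonzero in U ⧸ W. -/
theorem exists_forall_sum_zpow_ne_zero {κ U : Type*} [Fintype κ] [AddCommGroup U]
    [Module ℚ U] [FiniteDimensional ℚ U] (ρ : G →* Module.End ℚ U) {g : G}
    (hg : ∀ k : ℕ, k ≠ 0 → ∀ v, ρ (g ^ k) v = v → v = 0) {u : κ → U} (hu : ∃ i, u i ≠ 0) :
    ∃ M : ℤ, ∀ n : κ → ℤ, (∀ i j, i ≠ j → M ≤ |n i - n j|) → ∑ i, ρ (g ^ n i) (u i) ≠ 0 := by
  induction hd : Module.finrank ℚ U using Nat.strong_induction_on generalizing U with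
  | _ d ih =>
  subst hd
  by_cases hirr : ∀ W : Submodule ℚ U, (∀ g, ∀ w ∈ W, ρ g w ∈ W) → W = ⊥ ∨ W = ⊤
  · exact exists_forall_sum_zpow_ne_zero_of_irreducible ρ hirr hg hu
  push Not at hirr
  obtain ⟨W, hW, hbot, htop⟩ := hirr
  have hst : ∀ g ∈ (⊤ : Subgroup G), ∀ w ∈ W, ρ g w ∈ W := fun g _ => hW g
  let e : G →* (⊤ : Subgroup G) := Subgroup.topEquiv.symm.toMonoidHom
  by_cases hmem : ∀ i, u i ∈ W
  · obtain ⟨M, hM⟩ := ih _ (Submodule.finrank_lt htop) ((restrictRep ρ ⊤ W hst).comp e)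
      (u := fun i => ⟨u i, hmem i⟩) (fun k hk v hv => Subtype.ext
        (hg k hk v (congrArg Subtype.val hv))) (by
        obtain ⟨i, hi⟩ := hu
        exact ⟨i, fun h => hi (congrArg Subtype.val h)⟩) rfl
    refine ⟨M, fun n hn hsum => hM n hn (Subtype.ext ?_)⟩
    rw [AddSubmonoidClass.coe_finsetSum]
    exact hsum
  · push Not at hmem
    have hlt : Module.finrank ℚ (U ⧸ W) < Module.finrank ℚ U := by
      have h1 := W.finrank_quotient_add_finrank
      have h2 : Module.finrank ℚ W ≠ 0 := fun h => hbot (Submodule.finrank_eq_zero.mp h)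
      lia
    obtain ⟨M, hM⟩ := ih _ hlt ((quotientRep ρ ⊤ W hst).comp e)
      (u := fun i => Submodule.Quotient.mk (u i)) (by
        intro k hk v hv
        obtain ⟨v, rfl⟩ := Submodule.Quotient.mk_surjective W v
        have hv' : ρ (g ^ k) v - v ∈ W := (Submodule.Quotient.eq W).mp hv
        -- The hypothesis on g passes to the quotient: g ^ k - 1 is injective, hence surjective, on
        -- W, so a vector fixed modulo W can be corrected by an element of W to a genuinely fixed
        -- one.
        let T : W →ₗ[ℚ] W := (ρ (g ^ k) - 1).restrict fun w hw => W.sub_mem (hW _ w hw) hw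
        have hT : Function.Injective T := by
          rw [← LinearMap.ker_eq_bot, LinearMap.ker_eq_bot']
          intro w hw
          exact Subtype.ext (hg k hk w (sub_eq_zero.mp (congrArg Subtype.val hw)))
        obtain ⟨w, hw⟩ := LinearMap.injective_iff_surjective.mp hT ⟨_, hv'⟩
        have hw' : ρ (g ^ k) w - w = ρ (g ^ k) v - v := congrArg Subtype.val hw
        have h0 : v - w = 0 := by
          refine hg k hk _ ?_
          rw [map_sub, sub_eq_sub_iff_sub_eq_sub]
          exact hw'.symm
        rw [Submodule.Quotient.mk_eq_zero, sub_eq_zero.mp h0]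
        exact w.2) (by
        obtain ⟨i, hi⟩ := hmem
        exact ⟨i, fun h => hi ((Submodule.Quotient.mk_eq_zero W).mp h)⟩) rfl
    refine ⟨M, fun n hn hsum => hM n hn ?_⟩
    have := congrArg W.mkQ hsum
    rw [map_sum, map_zero] at this
    exact this

end CommGroupRepresentation

/-! ### Compact operators and the separation of points by characters -/

theorem Module.End.exists_common_eigenvector {ι E : Type*} [AddCommGroup E] [Module ℂ E]
    [FiniteDimensional ℂ E] [Nontrivial E] (A : ι → Module.End ℂ E)
    (hA : ∀ i j, Commute (A i) (A j)) : ∃ v ≠ 0, ∀ i, ∃ c : ℂ, A i v = c • v := by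
  induction hd : Module.finrank ℂ E using Nat.strong_induction_on generalizing E with
  | _ d ih =>
  subst hd
  by_cases hs : ∀ i, ∃ c : ℂ, ∀ v, A i v = c • v
  · obtain ⟨v, hv⟩ := exists_ne (0 : E)
    exact ⟨v, hv, fun i => (hs i).imp fun c hc => hc v⟩
  push Not at hs
  obtain ⟨i, hi⟩ := hs
  obtain ⟨c, hc⟩ := Module.End.exists_eigenvalue (A i)
  set W := (A i).eigenspace c
  have hWtop : W ≠ ⊤ := by
    intro h
    obtain ⟨v, hv⟩ := hi c
    exact hv (Module.End.mem_eigenspace_iff.mp (show v ∈ W from h ▸ Submodule.mem_top))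
  have hst : ∀ j, ∀ w ∈ W, A j w ∈ W := by
    intro j w hw
    rw [Module.End.mem_eigenspace_iff] at hw ⊢
    have := LinearMap.congr_fun (hA i j).eq w
    simp only [Module.End.mul_apply] at this
    rw [this, hw, map_smul]
  have : Nontrivial W := Submodule.nontrivial_iff_ne_bot.mpr hc
  obtain ⟨v, hv, hv'⟩ := ih _ (Submodule.finrank_lt hWtop) (fun j => (A j).restrict (hst j))
    (fun j k => LinearMap.ext fun w => Subtype.ext (LinearMap.congr_fun (hA j k).eq (w : E))) rfl
  refine ⟨v, fun h => hv (Subtype.ext h), fun j => ?_⟩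
  obtain ⟨b, hb⟩ := hv' j
  exact ⟨b, congrArg Subtype.val hb⟩

section UnitaryRepresentation

variable {X H : Type*} [CommGroup X] [TopologicalSpace X] [NormedAddCommGroup H]
  [InnerProductSpace ℂ H]

theorem exists_character_of_common_eigenvector (L : X →* (H ≃ₗᵢ[ℂ] H))
    (hL : ∀ f : H, Continuous fun a => L a f) {f : H} (hf : f ≠ 0)
    (h : ∀ a, ∃ c : ℂ, L a f = c • f) : ∃ χ : PontryaginDual X, ∀ a, L a f = (χ a : ℂ) • f := by
  choose c hc using h
  have hinj : ∀ {b b' : ℂ}, b • f = b' • f → b = b' := fun h => smul_left_injective ℂ hf h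
  have hnorm : ∀ a, ‖c a‖ = 1 := by
    intro a
    have h1 : ‖L a f‖ = ‖f‖ := (L a).norm_map f
    rw [hc, norm_smul] at h1
    exact mul_right_cancel₀ (norm_ne_zero_iff.mpr hf) (by rw [h1, one_mul])
  have hone : c 1 = 1 := hinj (by rw [← hc, map_one, one_smul]; rfl)
  have hmul : ∀ a b, c (a * b) = c a * c b := by
    intro a b
    refine hinj ?_
    rw [← hc, map_mul]
    change L a (L b f) = _
    rw [hc b, map_smul, hc a, smul_smul, mul_comm]
  have hcont : Continuous c := by
    have h1 : c = fun a => inner ℂ f (L a f) / inner ℂ f f := by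
      funext a
      rw [hc, inner_smul_right, mul_div_cancel_right₀ _ (inner_self_ne_zero.mpr hf)]
    rw [h1]
    exact (Continuous.inner continuous_const (hL f)).div_const _
  let χ : X →ₜ* Circle :=
    { toFun := fun a => ⟨c a, by simp [Submonoid.unitSphere, hnorm a]⟩
      map_one' := Circle.ext hone
      map_mul' := fun a b => Circle.ext (hmul a b)
      continuous_toFun := hcont.subtype_mk fun a => by simp [Submonoid.unitSphere, hnorm a] }
  exact ⟨χ, hc⟩

/-- The operator T*T is compact, self-adjoint, nonzero and commutes with L. It has an eigenspace
with nonzero eigenvalue; this is finite-dimensional and L-invariant, so it contains a common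
eigenvector f, and T f ≠ 0 because T*T f ≠ 0. -/
theorem exists_character_of_isCompactOperator [CompleteSpace H] (L : X →* (H ≃ₗᵢ[ℂ] H))
    (hL : ∀ f : H, Continuous fun a => L a f) (T : H →L[ℂ] H) (hT : IsCompactOperator T)
    (hT0 : T ≠ 0) (hTL : ∀ a f, T (L a f) = L a (T f)) :
    ∃ (f : H) (χ : PontryaginDual X), T f ≠ 0 ∧ ∀ a, L a f = (χ a : ℂ) • f := by
  have hinv : ∀ a u v, inner ℂ u (L a v) = inner ℂ (L a⁻¹ u) v := by
    intro a u v
    rw [← (L a).inner_map_map (L a⁻¹ u) v]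
    change _ = inner ℂ ((L a * L a⁻¹) u) _
    rw [← map_mul, mul_inv_cancel, map_one]
    rfl
  have hadj : ∀ a f, T.adjoint (L a f) = L a (T.adjoint f) := by
    intro a f
    refine ext_inner_left ℂ fun w => ?_
    rw [ContinuousLinearMap.adjoint_inner_right, hinv, ← hTL, hinv,
      ContinuousLinearMap.adjoint_inner_right]
  let M : H →L[ℂ] H := T.adjoint ∘L T
  have hM : IsCompactOperator M := hT.clm_comp T.adjoint
  have hM0 : M ≠ 0 := by
    intro h
    refine hT0 (ContinuousLinearMap.ext fun f => ?_)
    have h1 : inner ℂ f (M f) = inner ℂ (T f) (T f) :=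
        ContinuousLinearMap.adjoint_inner_right T f (T f)
    rw [h, zero_apply, inner_zero_right] at h1
    simpa using h1.symm
  have hMs : M.IsSymmetric := by
    intro u v
    change inner ℂ (T.adjoint (T u)) v = inner ℂ u (T.adjoint (T v))
    rw [ContinuousLinearMap.adjoint_inner_left, ContinuousLinearMap.adjoint_inner_right]
  obtain ⟨c, hc, hc0⟩ : ∃ c, Module.End.HasEigenvalue (M : Module.End ℂ H) c ∧ c ≠ 0 := by
    by_contra! h
    exact hM0 ((ContinuousLinearMap.eq_zero_of_forall_hasEigenvalue_eq_zero hM hMs).mp h)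
  have hfd := ContinuousLinearMap.finite_dimensional_eigenspace hM c hc0
  set E := Module.End.eigenspace (M : Module.End ℂ H) c
  have : Nontrivial E := Submodule.nontrivial_iff_ne_bot.mpr hc
  have hst : ∀ a, ∀ w ∈ E, (L a).toLinearEquiv.toLinearMap w ∈ E := by
    intro a w hw
    rw [Module.End.mem_eigenspace_iff] at hw ⊢
    change T.adjoint (T w) = c • w at hw
    change T.adjoint (T (L a w)) = c • L a w
    rw [hTL, hadj, hw, map_smul]
  obtain ⟨f, hf, hf'⟩ := Module.End.exists_common_eigenvector
    (fun a => (L a).toLinearEquiv.toLinearMap.restrict (hst a)) (by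
      intro a b
      refine LinearMap.ext fun w => Subtype.ext ?_
      change (L a * L b) (w : H) = (L b * L a) (w : H)
      rw [← map_mul, mul_comm, map_mul])
  have hf0 : (f : H) ≠ 0 := fun h => hf (Subtype.ext h)
  obtain ⟨χ, hχ⟩ := exists_character_of_common_eigenvector L hL hf0 fun a => by
    obtain ⟨b, hb⟩ := hf' a
    exact ⟨b, congrArg Subtype.val hb⟩
  refine ⟨f, χ, fun h => ?_, hχ⟩
  have h1 : T.adjoint (T f) = c • (f : H) := Module.End.mem_eigenspace_iff.mp f.2
  rw [h, map_zero] at h1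
  exact smul_ne_zero hc0 hf0 h1.symm

end UnitaryRepresentation

section InnerKernel

variable {X H : Type*} [TopologicalSpace X] [CompactSpace X] [NormedAddCommGroup H]
  [InnerProductSpace ℂ H]

/-- The operator `h ↦ (x ↦ ⟪κ x, h⟫)` for a continuous family of vectors `κ`. -/
noncomputable def innerOperator (κ : C(X, H)) : H →L[ℂ] BoundedContinuousFunction X ℂ :=
  LinearMap.mkContinuous
    { toFun := fun h => BoundedContinuousFunction.mkOfCompact
        ⟨fun x => inner ℂ (κ x) h, κ.continuous.inner continuous_const⟩
      map_add' := fun h h' => by ext x; exact inner_add_right _ _ _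
      map_smul' := fun c h => by ext x; exact inner_smul_right _ _ _ } ‖κ‖ (by
    intro h
    refine (BoundedContinuousFunction.norm_le (by positivity)).mpr fun x => ?_
    refine (norm_inner_le_norm (𝕜 := ℂ) (κ x) h).trans ?_
    gcongr
    exact κ.norm_coe_le_norm x)

/-- Arzelà–Ascoli: continuity of κ makes the image of the unit ball equicontinuous. -/
theorem isCompactOperator_innerOperator (κ : C(X, H)) : IsCompactOperator (innerOperator κ) := by
  refine (isCompactOperator_iff_isCompact_closure_image_closedBall
    (innerOperator κ : H →ₗ[ℂ] BoundedContinuousFunction X ℂ) one_pos).mpr ?_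
  refine BoundedContinuousFunction.arzela_ascoli (Metric.closedBall 0 ‖κ‖)
    (isCompact_closedBall _ _) _ ?_ ?_
  · rintro _ x ⟨h, hh, rfl⟩
    rw [mem_closedBall_zero_iff] at hh ⊢
    refine (norm_inner_le_norm (𝕜 := ℂ) (κ x) h).trans ?_
    calc ‖κ x‖ * ‖h‖ ≤ ‖κ‖ * 1 := by
          gcongr
          exact κ.norm_coe_le_norm x
      _ = ‖κ‖ := mul_one _
  · intro x₀
    rw [Metric.equicontinuousAt_iff_right]
    intro ε hε
    filter_upwards [(Metric.continuousAt_iff'.mp κ.continuous.continuousAt ε hε)] with x hx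
    rintro ⟨_, h, hh, rfl⟩
    rw [mem_closedBall_zero_iff] at hh
    change dist (inner ℂ (κ x₀) h) (inner ℂ (κ x) h) < ε
    rw [dist_eq_norm, ← inner_sub_left]
    refine lt_of_le_of_lt (norm_inner_le_norm (𝕜 := ℂ) _ h) ?_
    rw [dist_comm, dist_eq_norm] at hx
    calc ‖κ x₀ - κ x‖ * ‖h‖ ≤ ‖κ x₀ - κ x‖ * 1 := by gcongr
      _ < ε := by rwa [mul_one]

end InnerKernel

section SeparatesPoints

variable {X : Type*} [CommGroup X] [TopologicalSpace X] [IsTopologicalGroup X] [CompactSpace X]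

instance normalizedHaar.isHaarMeasure [MeasurableSpace X] [BorelSpace X] :
    (normalizedHaar X).IsHaarMeasure := by
  unfold normalizedHaar; infer_instance

instance normalizedHaar.isProbabilityMeasure [MeasurableSpace X] [BorelSpace X] :
    IsProbabilityMeasure (normalizedHaar X) :=
  ⟨Measure.haarMeasure_self (K₀ := (⊤ : TopologicalSpace.PositiveCompacts X))⟩

instance normalizedHaar.regular [MeasurableSpace X] [BorelSpace X] :
    (normalizedHaar X).Regular := by
  unfold normalizedHaar; infer_instance

/-- The regular representation of a compact abelian group on `L²`. -/
noncomputable def regularRep (X : Type*) [CommGroup X] [TopologicalSpace X] [IsTopologicalGroup X]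
    [CompactSpace X] [MeasurableSpace X] [BorelSpace X] :
    X →* (Lp ℂ 2 (normalizedHaar X) ≃ₗᵢ[ℂ] Lp ℂ 2 (normalizedHaar X)) where
  toFun a :=
    { toFun := fun f => DomMulAct.mk a • f
      invFun := fun f => DomMulAct.mk a⁻¹ • f
      map_add' := smul_add _
      map_smul' := fun c f => smul_comm _ _ _
      left_inv := fun f => by
        change DomMulAct.mk a⁻¹ • DomMulAct.mk a • f = f
        rw [smul_smul, ← DomMulAct.mk_mul, mul_inv_cancel, DomMulAct.mk_one, one_smul]
      right_inv := fun f => by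
        change DomMulAct.mk a • DomMulAct.mk a⁻¹ • f = f
        rw [smul_smul, ← DomMulAct.mk_mul, inv_mul_cancel, DomMulAct.mk_one, one_smul]
      norm_map' := DomMulAct.norm_smul_Lp _ }
  map_one' := by
    ext1 f
    exact one_smul Xᵈᵐᵃ f
  map_mul' a b := by
    ext1 f
    change DomMulAct.mk (a * b) • f = DomMulAct.mk a • DomMulAct.mk b • f
    rw [smul_smul, ← DomMulAct.mk_mul, mul_comm]

theorem continuous_regularRep [MeasurableSpace X] [BorelSpace X]
    (f : Lp ℂ 2 (normalizedHaar X)) : Continuous fun a => regularRep X a f := by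
  have : Fact ((2 : ENNReal) ≠ ⊤) := ⟨by simp⟩
  exact (DomMulAct.continuous_mk (M := X)).smul continuous_const

theorem regularRep_inner [MeasurableSpace X] [BorelSpace X] (a : X)
    (f g : Lp ℂ 2 (normalizedHaar X)) :
    inner ℂ f (regularRep X a g) = inner ℂ (regularRep X a⁻¹ f) g := by
  rw [← (regularRep X a).inner_map_map (regularRep X a⁻¹ f) g]
  change _ = inner ℂ ((regularRep X a * regularRep X a⁻¹) f) _
  rw [← map_mul, mul_inv_cancel, map_one]
  rfl

theorem regularRep_toLp [MeasurableSpace X] [BorelSpace X] (a : X)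
    (k : BoundedContinuousFunction X ℂ) :
    regularRep X a (BoundedContinuousFunction.toLp 2 (normalizedHaar X) ℂ k) =
      BoundedContinuousFunction.toLp 2 (normalizedHaar X) ℂ
        (k.compContinuous ⟨fun x => a * x, continuous_const_mul a⟩) := rfl

/-- Characters separate the points of a compact Hausdorff abelian group. -/
theorem exists_pontryaginDual_apply_ne_one [T2Space X] {x₀ : X} (hx₀ : x₀ ≠ 1) :
    ∃ χ : PontryaginDual X, χ x₀ ≠ 1 := by
  borelize X
  set μ := normalizedHaar X
  let L := regularRep X
  let J : BoundedContinuousFunction X ℂ →L[ℂ] Lp ℂ 2 μ := BoundedContinuousFunction.toLp 2 μ ℂ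
  have hJ : Function.Injective J := BoundedContinuousFunction.toLp_injective μ
  obtain ⟨k, hk0, hk1, -⟩ := exists_continuous_zero_one_of_isClosed
    (isClosed_singleton (x := (1 : X))) (isClosed_singleton (x := x₀⁻¹))
    (Set.disjoint_singleton.mpr (fun h => hx₀ (by rw [← inv_inv x₀, ← h, inv_one])))
  let k' : BoundedContinuousFunction X ℂ :=
    BoundedContinuousFunction.mkOfCompact ⟨fun x => (k x : ℂ), by fun_prop⟩
  -- A difference of this shape, and all its translates, are orthogonal to every vector fixed by `L
  -- x₀`.
  let φ : Lp ℂ 2 μ := J k' - L x₀⁻¹ (J k')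
  have hφ : φ ≠ 0 := by
    intro h
    have h1 : J k' = J (k'.compContinuous ⟨fun x => x₀⁻¹ * x, continuous_const_mul _⟩) :=
      (sub_eq_zero.mp h).trans (regularRep_toLp x₀⁻¹ k')
    have h2 := DFunLike.congr_fun (hJ h1) 1
    have h3 : (k 1 : ℂ) = k (x₀⁻¹ * 1) := h2
    rw [mul_one, hk0 rfl, hk1 rfl] at h3
    simp at h3
  let κ : C(X, Lp ℂ 2 μ) := ⟨fun x => L x⁻¹ φ, (continuous_regularRep φ).comp continuous_inv⟩
  -- A convolution operator commuting with translations; it is nonzero since `innerOperator κ φ`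
  -- takes the value ‖φ‖² at 1. A character trivial at x₀ would give an eigenvector fixed by `L x₀`,
  -- which T kills.
  let T : Lp ℂ 2 μ →L[ℂ] Lp ℂ 2 μ := J ∘L innerOperator κ
  have hT : IsCompactOperator T := (isCompactOperator_innerOperator κ).clm_comp J
  have hT0 : T ≠ 0 := by
    intro h
    have h1 : J (innerOperator κ φ) = J 0 := by
      rw [map_zero]; exact DFunLike.congr_fun h φ
    have h2 : inner ℂ (L (1 : X)⁻¹ φ) φ = (0 : ℂ) := DFunLike.congr_fun (hJ h1) 1
    rw [inv_one, map_one] at h2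
    exact hφ (inner_self_eq_zero.mp h2)
  have hTL : ∀ a f, T (L a f) = L a (T f) := by
    intro a f
    refine Eq.trans ?_ (regularRep_toLp a (innerOperator κ f)).symm
    refine congrArg J (BoundedContinuousFunction.ext fun x => ?_)
    change inner ℂ (L x⁻¹ φ) (L a f) = inner ℂ (L (a * x)⁻¹ φ) f
    rw [regularRep_inner, mul_inv, map_mul]
    rfl
  obtain ⟨f, χ, hf, hχ⟩ := exists_character_of_isCompactOperator L continuous_regularRep
      T hT hT0 hTL
  refine ⟨χ, fun h => hf ?_⟩
  have hfix : L x₀ f = f := by rw [hχ, h]; simp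
  have hzero : innerOperator κ f = 0 := by
    refine BoundedContinuousFunction.ext fun x => ?_
    change inner ℂ (L x⁻¹ φ) f = (0 : ℂ)
    rw [← inv_inv (x⁻¹), inv_inv, ← regularRep_inner, inner_sub_left, sub_eq_zero,
      ← regularRep_inner]
    change _ = inner ℂ (J k') ((L x₀ * L x) f)
    rw [← map_mul, mul_comm, map_mul]
    change _ = inner ℂ (J k') (L x (L x₀ f))
    rw [hfix]
  change J (innerOperator κ f) = 0
  rw [hzero, map_zero]

end SeparatesPoints

/-! ### Density and orthogonality of characters -/

theorem PontryaginDual.pow_apply {X : Type*} [CommGroup X] [TopologicalSpace X]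
    (χ : PontryaginDual X) (n : ℕ) (x : X) : (χ ^ n) x = χ x ^ n := by
  induction n with
  | zero => rw [pow_zero, pow_zero]; rfl
  | succ n ih => rw [pow_succ, pow_succ, ← ih]; rfl

section Characters

variable {X : Type*} [CommGroup X] [TopologicalSpace X]

/-- A character as a continuous complex function. -/
noncomputable def dualChar (X : Type*) [CommGroup X] [TopologicalSpace X] :
    PontryaginDual X →* C(X, ℂ) where
  toFun χ := ⟨fun x => (χ x : ℂ), continuous_subtype_val.comp (map_continuous χ)⟩
  map_one' := rfl
  map_mul' _ _ := rfl

theorem dualChar_apply (χ : PontryaginDual X) (x : X) : dualChar X χ x = (χ x : ℂ) := rfl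

theorem dualChar_inv (χ : PontryaginDual X) : dualChar X χ⁻¹ = star (dualChar X χ) := by
  ext x
  exact Circle.coe_inv_eq_conj (χ x)

theorem norm_dualChar_apply (χ : PontryaginDual X) (x : X) : ‖dualChar X χ x‖ = 1 :=
  Circle.norm_coe _

variable [IsTopologicalGroup X] [CompactSpace X]

/-- Stone–Weierstrass: since S is a group, its span is already a star subalgebra. -/
theorem topologicalClosure_span_dualChar (S : Subgroup (PontryaginDual X))
    (hS : ∀ x : X, x ≠ 1 → ∃ χ ∈ S, χ x ≠ 1) :
    (Submodule.span ℂ (dualChar X '' S)).topologicalClosure = ⊤ := by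
  let A : StarSubalgebra ℂ C(X, ℂ) :=
    { Algebra.adjoin ℂ (dualChar X '' S) with
      star_mem' := by
        intro a ha
        change a ∈ Algebra.adjoin ℂ (dualChar X '' S) at ha
        change star a ∈ Algebra.adjoin ℂ (dualChar X '' S)
        induction ha using Algebra.adjoin_induction with
        | mem x hx =>
          obtain ⟨χ, hχ, rfl⟩ := hx
          exact Algebra.subset_adjoin ⟨χ⁻¹, S.inv_mem hχ, dualChar_inv χ⟩
        | algebraMap r => rw [← algebraMap_star_comm]; exact Subalgebra.algebraMap_mem _ _
        | add x y _ _ hx hy => rw [star_add]; exact add_mem hx hy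
        | mul x y _ _ hx hy => rw [star_mul]; exact mul_mem hy hx }
  have hA : A.SeparatesPoints := by
    intro x y hxy
    obtain ⟨χ, hχ, h⟩ := hS (x / y) (div_ne_one.mpr hxy)
    refine ⟨_, ⟨dualChar X χ, Algebra.subset_adjoin ⟨χ, hχ, rfl⟩, rfl⟩, fun h' => h ?_⟩
    have h2 : χ x = χ y := Circle.ext h'
    rw [map_div, h2, div_self']
  have h1 := ContinuousMap.starSubalgebra_topologicalClosure_eq_top_of_separatesPoints A hA
  have h2 : (A : Set C(X, ℂ)) = Submodule.span ℂ (dualChar X '' S) := by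
    have h3 := Algebra.adjoin_eq_span ℂ (dualChar X '' S)
    have h4 : ((S.toSubmonoid.map (dualChar X) : Submonoid C(X, ℂ)) : Set C(X, ℂ)) =
      dualChar X '' S := rfl
    rw [← h4, Submonoid.closure_eq, h4] at h3
    exact congrArg SetLike.coe h3
  refine SetLike.coe_injective ?_
  rw [Submodule.topologicalClosure_coe, ← h2, ← StarSubalgebra.topologicalClosure_coe, h1]
  rfl

variable [MeasurableSpace X] [BorelSpace X]

theorem integral_dualChar {χ : PontryaginDual X} (hχ : χ ≠ 1) :
    ∫ x, dualChar X χ x ∂(normalizedHaar X) = 0 := by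
  obtain ⟨a, ha⟩ : ∃ a, χ a ≠ 1 := by
    by_contra! h
    exact hχ (PontryaginDual.ext h)
  have h1 := integral_mul_left_eq_self (μ := normalizedHaar X) (fun x => dualChar X χ x) a
  have h2 : ∀ x, dualChar X χ (a * x) = (χ a : ℂ) * dualChar X χ x := fun x => by
    change ((χ (a * x) : Circle) : ℂ) = _
    rw [map_mul, Circle.coe_mul]
    rfl
  simp only [h2] at h1
  rw [integral_const_mul] at h1
  by_contra h0
  have h3 := mul_right_cancel₀ h0 (h1.trans (one_mul _).symm)
  exact ha (Circle.ext h3)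

/-- The Haar integral as a continuous functional. -/
noncomputable def haarIntegral (X : Type*) [CommGroup X] [TopologicalSpace X]
    [IsTopologicalGroup X] [CompactSpace X] [MeasurableSpace X] [BorelSpace X] :
    C(X, ℂ) →L[ℂ] ℂ :=
  LinearMap.mkContinuous
    { toFun := fun f => ∫ x, f x ∂(normalizedHaar X)
      map_add' := fun f g => integral_add
        (f.continuous.integrable_of_hasCompactSupport (HasCompactSupport.of_compactSpace _))
        (g.continuous.integrable_of_hasCompactSupport (HasCompactSupport.of_compactSpace _))
      map_smul' := fun c f => integral_smul c f } 1 (by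
    intro f
    refine (norm_integral_le_of_norm_le_const (C := ‖f‖)
      (Eventually.of_forall fun x => f.norm_coe_le_norm x)).trans ?_
    simp)

/-- For χ outside S, integration against the conjugate of χ kills the dense span of S by
orthogonality, yet it is 1 on χ itself. -/
theorem eq_top_of_separates {S : Subgroup (PontryaginDual X)}
    (hS : ∀ x : X, x ≠ 1 → ∃ χ ∈ S, χ x ≠ 1) : S = ⊤ := by
  rw [Subgroup.eq_top_iff']
  intro χ
  by_contra hχ
  let Φ : C(X, ℂ) →L[ℂ] ℂ := haarIntegral X ∘L (ContinuousLinearMap.mul ℂ C(X, ℂ) (dualChar X χ⁻¹))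
  have hΦ : ∀ f, Φ f = ∫ x, (dualChar X χ⁻¹ * f) x ∂(normalizedHaar X) := fun f => rfl
  have hker : LinearMap.ker (Φ : C(X, ℂ) →ₗ[ℂ] ℂ) = ⊤ := by
    rw [eq_top_iff, ← topologicalClosure_span_dualChar S hS]
    refine Submodule.topologicalClosure_minimal _ (Submodule.span_le.mpr ?_) Φ.isClosed_ker
    rintro _ ⟨ψ, hψ, rfl⟩
    change Φ _ = 0
    rw [hΦ, ← map_mul]
    refine integral_dualChar fun h => hχ ?_
    rw [inv_mul_eq_one.mp h]
    exact hψ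
  have h1 : Φ (dualChar X χ) = 0 := by
    have : dualChar X χ ∈ LinearMap.ker (Φ : C(X, ℂ) →ₗ[ℂ] ℂ) := hker ▸ Submodule.mem_top
    exact this
  rw [hΦ, ← map_mul, inv_mul_cancel, map_one] at h1
  simp at h1

end Characters

/-! ### Annihilators, connectedness and torsion -/

section Duality

variable {X : Type*} [CommGroup X] [TopologicalSpace X]

/-- The restriction of characters to a subgroup. -/
noncomputable def resDual (Y : Subgroup X) : PontryaginDual X →* PontryaginDual Y where
  toFun χ := PontryaginDual.map ⟨Y.subtype, continuous_subtype_val⟩ χ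
  map_one' := rfl
  map_mul' _ _ := rfl

/-- The common kernel of a set of characters. -/
def dualAnnihilator (B : Subgroup (PontryaginDual X)) : Subgroup X where
  carrier := {x | ∀ χ ∈ B, χ x = 1}
  one_mem' := fun χ _ => map_one χ
  mul_mem' := fun ha hb χ hχ => by rw [map_mul, ha χ hχ, hb χ hχ, one_mul]
  inv_mem' := fun ha χ hχ => by rw [map_inv, ha χ hχ, inv_one]

theorem mem_dualAnnihilator {B : Subgroup (PontryaginDual X)} {x : X} :
    x ∈ dualAnnihilator B ↔ ∀ χ ∈ B, χ x = 1 := Iff.rfl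

theorem isClosed_dualAnnihilator (B : Subgroup (PontryaginDual X)) :
    IsClosed (dualAnnihilator B : Set X) := by
  have : (dualAnnihilator B : Set X) = ⋂ χ ∈ B, {x | χ x = 1} := by
    ext x; simp [mem_dualAnnihilator]
  rw [this]
  exact isClosed_biInter fun χ _ => isClosed_eq (map_continuous χ) continuous_const

variable [IsTopologicalGroup X] [CompactSpace X]

/-- Restrictions of characters of X form a subgroup of the dual of Y that separates points. -/
theorem resDual_surjective [T2Space X] {Y : Subgroup X} (hY : IsClosed (Y : Set X)) :
    Function.Surjective (resDual Y) := by
  have : CompactSpace Y := isCompact_iff_compactSpace.mp hY.isCompact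
  let _ : MeasurableSpace Y := borel Y
  have : BorelSpace Y := ⟨rfl⟩
  rw [← MonoidHom.range_eq_top]
  refine eq_top_of_separates fun y hy => ?_
  obtain ⟨χ, hχ⟩ := exists_pontryaginDual_apply_ne_one (x₀ := (y : X)) fun h => hy (Subtype.ext h)
  exact ⟨_, ⟨χ, rfl⟩, hχ⟩

/-- Double annihilator theorem. -/
theorem mem_of_forall_dualAnnihilator {B : Subgroup (PontryaginDual X)} {χ : PontryaginDual X}
    (hχ : ∀ x ∈ dualAnnihilator B, χ x = 1) : χ ∈ B := by
  set Y := dualAnnihilator B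
  have hY : IsClosed (Y : Set X) := isClosed_dualAnnihilator B
  borelize (X ⧸ Y)
  let q : X →ₜ* (X ⧸ Y) := ⟨QuotientGroup.mk' Y, QuotientGroup.continuous_mk⟩
  -- The characters in B factor through X ⧸ Y and separate its points by the choice of Y, so they
  -- are all the characters of the quotient.
  let S : Subgroup (PontryaginDual (X ⧸ Y)) :=
    B.comap (PontryaginDual.map q : PontryaginDual (X ⧸ Y) →* PontryaginDual X)
  have hdesc : ∀ ψ : PontryaginDual X, (∀ x ∈ Y, ψ x = 1) →
      ∃ ψ' : PontryaginDual (X ⧸ Y), PontryaginDual.map q ψ' = ψ := by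
    intro ψ hψ
    let l : X ⧸ Y →* Circle := QuotientGroup.lift Y (ψ : X →* Circle) hψ
    have hl : Continuous l := Continuous.quotient_lift (map_continuous ψ) _
    let l' : X ⧸ Y →ₜ* Circle := ⟨l, hl⟩
    exact ⟨l', rfl⟩
  have hS : S = ⊤ := by
    refine eq_top_of_separates ?_
    intro x hx
    induction x using QuotientGroup.induction_on with | H x => ?_
    have hxY : x ∉ Y := fun h => hx ((QuotientGroup.eq_one_iff x).mpr h)
    rw [mem_dualAnnihilator] at hxY
    push Not at hxY
    obtain ⟨ψ, hψ, hψx⟩ := hxY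
    obtain ⟨ψ', rfl⟩ := hdesc ψ fun x hx => hx ψ hψ
    exact ⟨ψ', hψ, hψx⟩
  obtain ⟨χ', rfl⟩ := hdesc χ hχ
  exact (hS ▸ Subgroup.mem_top χ' : χ' ∈ S)

/-- A clopen set containing 1 contains an open subgroup H. The quotient by H is finite, so its
characters pull back to torsion characters of X, and H must be all of X. -/
theorem connectedSpace_of_dual_torsionFree
    (h : ∀ χ : PontryaginDual X, ∀ n : ℕ, n ≠ 0 → χ ^ n = 1 → χ = 1) : ConnectedSpace X := by
  have : PreconnectedSpace X := by
    rw [preconnectedSpace_iff_clopen]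
    have key : ∀ W : Set X, IsClopen W → (1 : X) ∈ W → W = Set.univ := by
      intro W hW h1
      obtain ⟨H, hH⟩ := IsTopologicalGroup.exist_openSubgroup_sub_clopen_nhds_of_one hW h1
      have hfin : Finite (X ⧸ H.toSubgroup) :=
        Subgroup.quotient_finite_of_isOpen H.toSubgroup H.isOpen
      have hcl : IsClosed (H.toSubgroup : Set X) := H.isClosed
      let q : X →ₜ* (X ⧸ H.toSubgroup) := ⟨QuotientGroup.mk' _, QuotientGroup.continuous_mk⟩
      refine Set.eq_univ_of_forall fun x => hH ?_
      by_contra hx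
      obtain ⟨χ, hχ⟩ := exists_pontryaginDual_apply_ne_one (x₀ := (x : X ⧸ H.toSubgroup))
        (fun h' => hx ((QuotientGroup.eq_one_iff x).mp h'))
      refine hχ ?_
      have h2 : PontryaginDual.map q χ = 1 := by
        refine h _ (Nat.card (X ⧸ H.toSubgroup)) Nat.card_pos.ne' ?_
        refine PontryaginDual.ext fun y => ?_
        rw [PontryaginDual.pow_apply, PontryaginDual.map_apply, ← map_pow,
            pow_card_eq_one', map_one]
        rfl
      exact DFunLike.congr_fun h2 x
    intro W hW
    by_cases h1 : (1 : X) ∈ W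
    · exact Or.inr (key W hW h1)
    · exact Or.inl (Set.compl_univ_iff.mp (by simpa using key Wᶜ hW.compl h1))
  exact ⟨⟨1⟩⟩

omit [IsTopologicalGroup X] [CompactSpace X] in
-- A torsion character takes finitely many values, so on a connected space it is constant.
theorem dual_torsionFree [ConnectedSpace X] {χ : PontryaginDual X} {n : ℕ} (hn : n ≠ 0)
    (h : χ ^ n = 1) : χ = 1 := by
  have hfin : (Set.range χ).Finite := by
    have hroots : {z : Circle | z ^ n = 1}.Finite := by
      refine Set.Finite.of_finite_image (f := fun z : Circle => (z : ℂ)) ?_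
        Circle.coe_injective.injOn
      refine (Polynomial.nthRoots n (1 : ℂ)).toFinset.finite_toSet.subset ?_
      rintro _ ⟨z, hz, rfl⟩
      simp only [Finset.mem_coe, Multiset.mem_toFinset]
      rw [Polynomial.mem_nthRoots (Nat.pos_of_ne_zero hn)]
      exact congrArg (fun z : Circle => (z : ℂ)) hz
    refine hroots.subset ?_
    rintro _ ⟨x, rfl⟩
    rw [Set.mem_ofPred_eq, ← PontryaginDual.pow_apply, h]
    rfl
  have hsub := hfin.countable.isTotallyDisconnected _ subset_rfl
    (isPreconnected_range (map_continuous χ))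
  exact PontryaginDual.ext fun x => (hsub ⟨x, rfl⟩ ⟨1, rfl⟩).trans (map_one χ)

end Duality

/-! ### From characters to measurable sets -/

section Mixing

variable {X : Type*} [CommGroup X] [TopologicalSpace X] [IsTopologicalGroup X] [CompactSpace X]
  [MeasurableSpace X] [BorelSpace X]

theorem ContinuousMap.integrable_normalizedHaar (f : C(X, ℂ)) :
    Integrable f (normalizedHaar X) :=
  f.continuous.integrable_of_hasCompactSupport (HasCompactSupport.of_compactSpace _)

/-- Trigonometric polynomials approximate integrable functions in mean. -/
theorem exists_mem_span_dualChar_integral_sub_le [T2Space X] {h : X → ℂ}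
    (hh : Integrable h (normalizedHaar X)) {ε : ℝ} (hε : 0 < ε) :
    ∃ p ∈ Submodule.span ℂ (Set.range (dualChar X)),
      ∫ x, ‖h x - p x‖ ∂(normalizedHaar X) ≤ ε := by
  obtain ⟨g, hg, -⟩ := hh.exists_boundedContinuous_integral_sub_le (half_pos hε)
  have hdense := topologicalClosure_span_dualChar (X := X) ⊤ fun x hx =>
    (exists_pontryaginDual_apply_ne_one hx).imp fun χ hχ => ⟨Subgroup.mem_top χ, hχ⟩
  have hmem : g.toContinuousMap ∈
      (Submodule.span ℂ (dualChar X '' (⊤ : Subgroup (PontryaginDual X)))).topologicalClosure := by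
    rw [hdense]; exact Submodule.mem_top
  rw [← SetLike.mem_coe, Submodule.topologicalClosure_coe, Metric.mem_closure_iff] at hmem
  obtain ⟨p, hp, hdist⟩ := hmem _ (half_pos hε)
  refine ⟨p, by simpa using hp, ?_⟩
  have hgi : Integrable (fun x => ‖h x - g x‖) (normalizedHaar X) :=
    (hh.sub (ContinuousMap.integrable_normalizedHaar g.toContinuousMap)).norm
  calc ∫ x, ‖h x - p x‖ ∂(normalizedHaar X)
      ≤ ∫ x, (‖h x - g x‖ + ε / 2) ∂(normalizedHaar X) := by
        refine integral_mono (hh.sub p.integrable_normalizedHaar).norm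
          (hgi.add (integrable_const _)) fun x => ?_
        calc ‖h x - p x‖ = ‖(h x - g x) + (g x - p x)‖ := by rw [sub_add_sub_cancel]
          _ ≤ ‖h x - g x‖ + ‖g x - p x‖ := norm_add_le _ _
          _ ≤ ‖h x - g x‖ + ε / 2 := by
            gcongr
            rw [← dist_eq_norm]
            exact (ContinuousMap.dist_apply_le_dist (f := g.toContinuousMap) (g := p) x).trans
              hdist.le
    _ = ∫ x, ‖h x - g x‖ ∂(normalizedHaar X) + ε / 2 := by
        rw [integral_add hgi (integrable_const _)]; simp
    _ ≤ ε := by linarith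

/-- Extension of a limit formula from characters to bounded functions, one factor at a time. -/
theorem tendsto_integral_mul_of_dualChar [T2Space X] {ι : Type*} {l : Filter ι} {S : ι → X → X}
    (hS : ∀ i, MeasurePreserving (S i) (normalizedHaar X) (normalizedHaar X)) {F : ι → X → ℂ}
    (hF : ∀ i, AEStronglyMeasurable (F i) (normalizedHaar X)) {C : ℝ} (hC : ∀ i x, ‖F i x‖ ≤ C)
    {c : ℂ} (h : ∀ χ : PontryaginDual X,
      Tendsto (fun i => ∫ x, dualChar X χ (S i x) * F i x ∂(normalizedHaar X)) l
        (𝓝 ((∫ x, dualChar X χ x ∂(normalizedHaar X)) * c)))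
    {f : X → ℂ} (hf : Integrable f (normalizedHaar X)) :
    Tendsto (fun i => ∫ x, f (S i x) * F i x ∂(normalizedHaar X)) l
      (𝓝 ((∫ x, f x ∂(normalizedHaar X)) * c)) := by
  have hint : ∀ {g : X → ℂ}, Integrable g (normalizedHaar X) → ∀ i, Integrable (fun x => g (S i x) * F i x) (normalizedHaar X) :=
    fun hg i => ((hS i).integrable_comp_of_integrable hg).mul_bdd (hF i)
      (Eventually.of_forall (hC i))
  have hspan : ∀ p ∈ Submodule.span ℂ (Set.range (dualChar X)),
      Tendsto (fun i => ∫ x, p (S i x) * F i x ∂(normalizedHaar X))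
          l (𝓝 ((∫ x, p x ∂(normalizedHaar X)) * c)) := by
    intro p hp
    induction hp using Submodule.span_induction with
    | mem p hp =>
      obtain ⟨χ, rfl⟩ := hp
      exact h χ
    | zero => simpa using tendsto_const_nhds
    | add p q _ _ hp hq =>
      have h1 : ∀ i, ∫ x, (p + q) (S i x) * F i x ∂(normalizedHaar X) =
          ∫ x, p (S i x) * F i x ∂(normalizedHaar X) +
              ∫ x, q (S i x) * F i x ∂(normalizedHaar X) := by
        intro i
        rw [← integral_add (hint p.integrable_normalizedHaar i)
          (hint q.integrable_normalizedHaar i)]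
        simp only [ContinuousMap.add_apply, add_mul]
      have h2 : ∫ x, (p + q) x ∂(normalizedHaar X) =
          ∫ x, p x ∂(normalizedHaar X) + ∫ x, q x ∂(normalizedHaar X) :=
        integral_add p.integrable_normalizedHaar q.integrable_normalizedHaar
      simp only [h1, h2, add_mul]
      exact hp.add hq
    | smul a p _ hp =>
      have h1 : ∀ i, ∫ x, (a • p) (S i x) * F i x ∂(normalizedHaar X) =
          a * ∫ x, p (S i x) * F i x ∂(normalizedHaar X) := by
        intro i
        rw [← integral_const_mul]
        simp only [ContinuousMap.smul_apply, smul_eq_mul, mul_assoc]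
      have h2 : ∫ x, (a • p) x ∂(normalizedHaar X) = a * ∫ x, p x ∂(normalizedHaar X) := by
        rw [← integral_const_mul]
        simp only [ContinuousMap.smul_apply, smul_eq_mul]
      simp only [h1, h2, mul_assoc]
      exact hp.const_mul a
  rw [Metric.tendsto_nhds]
  intro ε hε
  -- Replacing f by p costs at most δ|C| in the integral and δ‖c‖ in the limit; the added 1 keeps
  -- the divisor positive.
  have hden : 0 < |C| + ‖c‖ + 1 := by positivity
  obtain ⟨p, hp, hpε⟩ := exists_mem_span_dualChar_integral_sub_le hf
    (show 0 < ε / 2 / (|C| + ‖c‖ + 1) by positivity)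
  filter_upwards [(Metric.tendsto_nhds.mp (hspan p hp)) (ε / 2) (half_pos hε)] with i hi
  set δ := ∫ x, ‖f x - p x‖ ∂(normalizedHaar X)
  have hδ0 : 0 ≤ δ := integral_nonneg fun _ => norm_nonneg _
  have hfp := hf.sub p.integrable_normalizedHaar
  have h1 : ‖∫ x, f (S i x) * F i x ∂(normalizedHaar X) -
      ∫ x, p (S i x) * F i x ∂(normalizedHaar X)‖ ≤ δ * |C| := by
    rw [← integral_sub (hint hf i) (hint p.integrable_normalizedHaar i)]
    have h3 : δ * |C| = ∫ x, ‖f (S i x) - p (S i x)‖ * |C| ∂(normalizedHaar X) := by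
      rw [integral_mul_const]
      congr 1
      have h4 : AEStronglyMeasurable (fun x => ‖f x - p x‖)
          (Measure.map (S i) (normalizedHaar X)) := by
        rw [(hS i).map_eq]; exact hfp.norm.aestronglyMeasurable
      have := integral_map (hS i).measurable.aemeasurable h4
      rw [(hS i).map_eq] at this
      exact this
    rw [h3]
    refine norm_integral_le_of_norm_le
      ((((hS i).integrable_comp_of_integrable hfp).norm).mul_const _)
      (Eventually.of_forall fun x => ?_)
    rw [← sub_mul, norm_mul]
    gcongr
    exact (hC i x).trans (le_abs_self C)
  have h2 : ‖(∫ x, p x ∂(normalizedHaar X)) * c - (∫ x, f x ∂(normalizedHaar X)) * c‖ ≤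
      δ * ‖c‖ := by
    rw [← sub_mul, norm_mul, ← integral_sub p.integrable_normalizedHaar hf]
    gcongr
    refine (norm_integral_le_integral_norm _).trans (le_of_eq ?_)
    simp only [δ, norm_sub_rev]
  rw [dist_eq_norm] at hi ⊢
  have h3 : δ * (|C| + ‖c‖ + 1) ≤ ε / 2 := by rwa [le_div_iff₀ hden] at hpε
  have h4 : ∫ x, f (S i x) * F i x ∂(normalizedHaar X) - (∫ x, f x ∂(normalizedHaar X)) * c =
      (∫ x, f (S i x) * F i x ∂(normalizedHaar X) - ∫ x, p (S i x) * F i x ∂(normalizedHaar X)) +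
      (∫ x, p (S i x) * F i x ∂(normalizedHaar X) - (∫ x, p x ∂(normalizedHaar X)) * c) +
      ((∫ x, p x ∂(normalizedHaar X)) * c - (∫ x, f x ∂(normalizedHaar X)) * c) := by ring
  rw [h4]
  have h5 := norm_add₃_le (a := ∫ x, f (S i x) * F i x ∂(normalizedHaar X) -
      ∫ x, p (S i x) * F i x ∂(normalizedHaar X))
    (b := ∫ x, p (S i x) * F i x ∂(normalizedHaar X) - (∫ x, p x ∂(normalizedHaar X)) * c)
    (c := (∫ x, p x ∂(normalizedHaar X)) * c - (∫ x, f x ∂(normalizedHaar X)) * c)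
  nlinarith

theorem tendsto_integral_prod_of_dualChar [T2Space X] {ι κ : Type*} [Fintype κ] {l : Filter ι}
    {T : ι → κ → X → X}
    (hT : ∀ i k, MeasurePreserving (T i k) (normalizedHaar X) (normalizedHaar X))
    (h : ∀ χ : κ → PontryaginDual X, (∃ k, χ k ≠ 1) →
      ∀ᶠ i in l, ∫ x, ∏ k, dualChar X (χ k) (T i k x) ∂(normalizedHaar X) = 0)
    {f : κ → X → ℂ} (hf : ∀ k, AEStronglyMeasurable (f k) (normalizedHaar X))
    (hf1 : ∀ k x, ‖f k x‖ ≤ 1) :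
    Tendsto (fun i => ∫ x, ∏ k, f k (T i k x) ∂(normalizedHaar X)) l
      (𝓝 (∏ k, ∫ x, f k x ∂(normalizedHaar X))) := by
  classical
  -- Induction on the set s of indices whose function need not be a character; each step frees one
  -- factor.
  have key : ∀ s : Finset κ, ∀ f : κ → X → ℂ, (∀ k, AEStronglyMeasurable (f k) (normalizedHaar X)) →
      (∀ k x, ‖f k x‖ ≤ 1) → (∀ k ∉ s, ∃ χ, f k = dualChar X χ) →
      Tendsto (fun i => ∫ x, ∏ k, f k (T i k x) ∂(normalizedHaar X)) l
          (𝓝 (∏ k, ∫ x, f k x ∂(normalizedHaar X))) := by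
    intro s
    induction s using Finset.induction_on with
    | empty =>
      intro f _ _ hchar
      choose χ hχ using fun k => hchar k (Finset.notMem_empty k)
      obtain rfl : f = fun k => (dualChar X (χ k) : X → ℂ) := funext hχ
      by_cases hne : ∃ k, χ k ≠ 1
      · have h0 : ∏ k, ∫ x, dualChar X (χ k) x ∂(normalizedHaar X) = 0 := by
          obtain ⟨k, hk⟩ := hne
          exact Finset.prod_eq_zero (Finset.mem_univ k) (integral_dualChar hk)
        rw [h0]
        exact (tendsto_congr' (h χ hne)).mpr tendsto_const_nhds
      · push Not at hne
        simpa [hne] using tendsto_const_nhds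
    | insert a s ha ih =>
      intro f hfm hf1 hchar
      have hsplit : ∀ i x, ∏ k, f k (T i k x) =
          f a (T i a x) * ∏ k ∈ Finset.univ.erase a, f k (T i k x) := fun i x =>
        (Finset.mul_prod_erase _ (fun k => f k (T i k x)) (Finset.mem_univ a)).symm
      have hsplit' : ∏ k, ∫ x, f k x ∂(normalizedHaar X) =
          (∫ x, f a x ∂(normalizedHaar X)) *
              ∏ k ∈ Finset.univ.erase a, ∫ x, f k x ∂(normalizedHaar X) :=
        (Finset.mul_prod_erase _ (fun k => ∫ x, f k x ∂(normalizedHaar X)) (Finset.mem_univ a)).symm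
      simp only [hsplit, hsplit']
      refine tendsto_integral_mul_of_dualChar (S := fun i => T i a) (fun i => hT i a) (C := 1)
        (F := fun i x => ∏ k ∈ Finset.univ.erase a, f k (T i k x)) ?_ ?_ ?_
        ((integrable_const (1 : ℝ)).mono' (hfm a) (Eventually.of_forall (hf1 a)))
      · exact fun i => Finset.aestronglyMeasurable_fun_prod _ fun k _ =>
          (hfm k).comp_measurePreserving (hT i k)
      · intro i x
        rw [norm_prod]
        exact Finset.prod_le_one (fun _ _ => norm_nonneg _) fun k _ => hf1 k _
      · intro χ
        have := ih (Function.update f a (dualChar X χ)) ?_ ?_ ?_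
        · have h1 : ∀ i x, ∏ k, Function.update f a (dualChar X χ) k (T i k x) =
              dualChar X χ (T i a x) * ∏ k ∈ Finset.univ.erase a, f k (T i k x) := by
            intro i x
            rw [← Finset.mul_prod_erase _ _ (Finset.mem_univ a), Function.update_self]
            congr 1
            refine Finset.prod_congr rfl fun k hk => ?_
            rw [Function.update_of_ne (Finset.ne_of_mem_erase hk)]
          have h2 : ∏ k, ∫ x, Function.update f a (dualChar X χ) k x ∂(normalizedHaar X) =
              (∫ x, dualChar X χ x ∂(normalizedHaar X)) *
                  ∏ k ∈ Finset.univ.erase a, ∫ x, f k x ∂(normalizedHaar X) := by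
            rw [← Finset.mul_prod_erase _ _ (Finset.mem_univ a), Function.update_self]
            congr 1
            refine Finset.prod_congr rfl fun k hk => ?_
            rw [Function.update_of_ne (Finset.ne_of_mem_erase hk)]
          simpa only [h1, h2] using this
        · intro k
          by_cases hk : k = a
          · subst hk
            rw [Function.update_self]
            exact (dualChar X χ).integrable_normalizedHaar.aestronglyMeasurable
          · rw [Function.update_of_ne hk]; exact hfm k
        · intro k x
          by_cases hk : k = a
          · subst hk
            rw [Function.update_self]
            exact (norm_dualChar_apply χ x).le
          · rw [Function.update_of_ne hk]; exact hf1 k x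
        · intro k hk
          by_cases hka : k = a
          · subst hka
            exact ⟨χ, Function.update_self ..⟩
          · rw [Function.update_of_ne hka]
            exact hchar k (by simp [hka, hk])
  exact key Finset.univ f hf hf1 fun k hk => absurd (Finset.mem_univ k) hk

/-- Asymptotic orthogonality of products of characters implies mixing. -/
theorem tendsto_measure_iInter_preimage_of_dualChar [T2Space X] {ι κ : Type*} [Fintype κ]
    {l : Filter ι} {T : ι → κ → X → X}
    (hT : ∀ i k, MeasurePreserving (T i k) (normalizedHaar X) (normalizedHaar X))
    (h : ∀ χ : κ → PontryaginDual X, (∃ k, χ k ≠ 1) →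
      ∀ᶠ i in l, ∫ x, ∏ k, dualChar X (χ k) (T i k x) ∂(normalizedHaar X) = 0)
    {B : κ → Set X} (hB : ∀ k, NullMeasurableSet (B k) (normalizedHaar X)) :
    Tendsto (fun i => normalizedHaar X (⋂ k, T i k ⁻¹' B k)) l
      (𝓝 (∏ k, normalizedHaar X (B k))) := by
  classical
  have hlim := tendsto_integral_prod_of_dualChar hT h
    (f := fun k => (B k).indicator fun _ => (1 : ℂ))
    (fun k => aestronglyMeasurable_const.indicator₀ (hB k))
    (fun k x => by
      by_cases hx : x ∈ B k
      · simp [hx]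
      · simp [hx])
  have hint : ∀ {A : Set X}, NullMeasurableSet A (normalizedHaar X) →
      ∫ x, A.indicator (fun _ => (1 : ℂ)) x ∂(normalizedHaar X) = (normalizedHaar X).real A := by
    intro A hA
    rw [integral_indicator₀ hA]
    simp
  have hprod : ∀ i x, ∏ k, (B k).indicator (fun _ => (1 : ℂ)) (T i k x) =
      (⋂ k, T i k ⁻¹' B k).indicator (fun _ => (1 : ℂ)) x := by
    intro i x
    by_cases hx : x ∈ ⋂ k, T i k ⁻¹' B k
    · rw [Set.indicator_of_mem hx]
      refine Finset.prod_eq_one fun k _ =>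
        Set.indicator_of_mem (show T i k x ∈ B k from Set.mem_iInter.mp hx k) _
    · rw [Set.indicator_of_notMem hx]
      obtain ⟨k, hk⟩ : ∃ k, T i k x ∉ B k := by simpa using hx
      exact Finset.prod_eq_zero (Finset.mem_univ k) (Set.indicator_of_notMem hk _)
  have hnull : ∀ i, NullMeasurableSet (⋂ k, T i k ⁻¹' B k) (normalizedHaar X) := fun i =>
    NullMeasurableSet.iInter fun k => (hB k).preimage (hT i k).quasiMeasurePreserving
  simp only [hprod, hint (hnull _), hint (hB _)] at hlim
  have hreal : Tendsto (fun i => (normalizedHaar X).real (⋂ k, T i k ⁻¹' B k)) l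
      (𝓝 (∏ k, (normalizedHaar X).real (B k))) := by
    have := (Complex.continuous_re.tendsto _).comp hlim
    simpa only [Function.comp_def, ← Complex.ofReal_prod, Complex.ofReal_re] using this
  have := ENNReal.tendsto_ofReal hreal
  rw [ENNReal.ofReal_prod_of_nonneg fun _ _ => measureReal_nonneg] at this
  simpa only [Measure.real, ENNReal.ofReal_toReal (measure_ne_top _ _)] using this

/-- A real continuous function of zero mean which is positive somewhere is positive on a set of
measure neither zero nor one. -/
theorem measure_pos_ne_zero_ne_one {f : X → ℝ} (hf : Continuous f)
    (hint : ∫ x, f x ∂(normalizedHaar X) = 0) {x₀ : X} (hx₀ : 0 < f x₀) :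
    normalizedHaar X {x | 0 < f x} ≠ 0 ∧ normalizedHaar X {x | 0 < f x} ≠ 1 := by
  have hopen : IsOpen {x | 0 < f x} := isOpen_lt continuous_const hf
  have h0 : normalizedHaar X {x | 0 < f x} ≠ 0 := (hopen.measure_pos _ ⟨x₀, hx₀⟩).ne'
  refine ⟨h0, fun h1 => ?_⟩
  have hae : ∀ᵐ x ∂(normalizedHaar X), 0 < f x := by
    rw [← prob_compl_eq_zero_iff hopen.measurableSet] at h1
    exact h1
  have hfi : Integrable f (normalizedHaar X) :=
    hf.integrable_of_hasCompactSupport (HasCompactSupport.of_compactSpace _)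
  have h2 := (integral_eq_zero_iff_of_nonneg_ae (hae.mono fun x hx => hx.le) hfi).mp hint
  have h3 : ∀ᵐ x ∂(normalizedHaar X), False := by
    filter_upwards [hae, h2] with x hx hx'
    exact hx.ne' hx'
  rw [eventually_false_iff_eq_bot, ae_eq_bot] at h3
  exact NeZero.ne (normalizedHaar X) h3

end Mixing

/-! ### The rational dual space and its automorphisms -/

section DualSpace

open scoped TensorProduct

variable {X X' X'' : Type*} [CommGroup X] [TopologicalSpace X] [CommGroup X'] [TopologicalSpace X']
  [CommGroup X''] [TopologicalSpace X'']

/-- The rational vector space spanned by the character group. -/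
abbrev DualSpace (X : Type*) [CommGroup X] [TopologicalSpace X] : Type _ :=
  ℚ ⊗[ℤ] Additive (PontryaginDual X)

/-- The canonical map from the character group to the rational space it spans. -/
noncomputable def dualVec (X : Type*) [CommGroup X] [TopologicalSpace X] :
    Additive (PontryaginDual X) →ₗ[ℤ] DualSpace X :=
  TensorProduct.mk ℤ ℚ (Additive (PontryaginDual X)) 1

/-- The linear map induced on the dual spaces by a continuous homomorphism. -/
noncomputable def dualMap (f : X →ₜ* X') : DualSpace X' →ₗ[ℚ] DualSpace X :=
  (AddMonoidHom.toIntLinearMap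
    (MonoidHom.toAdditive (PontryaginDual.map f : PontryaginDual X' →* PontryaginDual X))).baseChange ℚ

theorem dualMap_dualVec (f : X →ₜ* X') (χ : PontryaginDual X') :
    dualMap f (dualVec X' (Additive.ofMul χ)) =
      dualVec X (Additive.ofMul (PontryaginDual.map f χ)) := by
  rfl

instance : IsLocalizedModule (nonZeroDivisors ℤ) (dualVec X) :=
  (isLocalizedModule_iff_isBaseChange (nonZeroDivisors ℤ) ℚ _).mpr
    (TensorProduct.isBaseChange ℤ (Additive (PontryaginDual X)) ℚ)

theorem DualSpace.eq_zero_of_zsmul_eq_zero {s : ℤ} (hs : s ≠ 0) {v : DualSpace X}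
    (h : s • v = 0) : v = 0 := by
  rw [← Int.cast_smul_eq_zsmul ℚ] at h
  exact (smul_eq_zero.mp h).resolve_left (Int.cast_ne_zero.mpr hs)

theorem exists_smul_eq_dualVec (v : DualSpace X) :
    ∃ s : ℤ, s ≠ 0 ∧ ∃ χ : PontryaginDual X, s • v = dualVec X (Additive.ofMul χ) := by
  obtain ⟨⟨χ, s⟩, h⟩ := IsLocalizedModule.surj (nonZeroDivisors ℤ) (dualVec X) v
  exact ⟨s, nonZeroDivisors.ne_zero s.2, χ.toMul, h⟩

theorem dualMap_ext {f g : DualSpace X →ₗ[ℚ] DualSpace X'}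
    (h : ∀ χ, f (dualVec X (Additive.ofMul χ)) = g (dualVec X (Additive.ofMul χ))) : f = g := by
  refine LinearMap.ext fun v => ?_
  obtain ⟨s, hs, χ, hχ⟩ := exists_smul_eq_dualVec v
  have h1 : s • f v = s • g v := by rw [← map_zsmul, ← map_zsmul, hχ, h]
  rw [← sub_eq_zero, ← smul_sub] at h1
  exact sub_eq_zero.mp (DualSpace.eq_zero_of_zsmul_eq_zero hs h1)

theorem dualMap_comp (f : X →ₜ* X') (g : X' →ₜ* X'') :
    dualMap (g.comp f) = (dualMap f).comp (dualMap g) := by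
  refine dualMap_ext fun χ => ?_
  rw [LinearMap.comp_apply, dualMap_dualVec, dualMap_dualVec, dualMap_dualVec]
  rfl

theorem dualMap_id : dualMap (ContinuousMonoidHom.id X) = LinearMap.id := by
  refine dualMap_ext fun χ => ?_
  rw [dualMap_dualVec]
  rfl

/-- Tensoring with ℚ kills exactly torsion, and the dual of a connected group has none. -/
theorem dualVec_eq_zero_iff [ConnectedSpace X] {χ : PontryaginDual X} :
    dualVec X (Additive.ofMul χ) = 0 ↔ χ = 1 := by
  refine ⟨fun h => ?_, fun h => by rw [h, ofMul_one, map_zero]⟩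
  rw [IsLocalizedModule.eq_zero_iff (nonZeroDivisors ℤ) (dualVec X)] at h
  obtain ⟨s, hs⟩ := h
  have hs' : χ ^ (s : ℤ) = 1 := hs
  have h0 : (s : ℤ).natAbs ≠ 0 := Int.natAbs_ne_zero.mpr (nonZeroDivisors.ne_zero s.2)
  refine dual_torsionFree h0 ?_
  rcases Int.natAbs_eq (s : ℤ) with h' | h'
  · rwa [h', zpow_natCast] at hs'
  · rwa [h', zpow_neg, zpow_natCast, inv_eq_one] at hs'

theorem finiteDimensional_dualSpace (h : charDim X < Cardinal.aleph0) :
    FiniteDimensional ℚ (DualSpace X) := by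
  rw [FiniteDimensional, ← Module.rank_lt_aleph0_iff,
    IsLocalization.rank_eq ℚ (nonZeroDivisors ℤ) le_rfl,
    IsLocalizedModule.rank_eq (nonZeroDivisors ℤ) le_rfl (dualVec X)]
  exact h

/-- An element of `continuousAut X` as a continuous homomorphism. -/
def continuousAutHom (g : continuousAut X) : X →ₜ* X :=
  ⟨(g : MulAut X).toMonoidHom, g.2.1⟩

/-- The action of `continuousAut X` on the dual space. -/
noncomputable def dualRep (X : Type*) [CommGroup X] [TopologicalSpace X] :
    continuousAut X →* Module.End ℚ (DualSpace X) where
  -- Pullback of characters is contravariant; the inverse makes it a left action.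
  toFun g := dualMap (continuousAutHom g⁻¹)
  map_one' := by
    rw [inv_one]
    exact dualMap_id
  map_mul' a b := by
    rw [mul_inv_rev]
    exact dualMap_comp (continuousAutHom a⁻¹) (continuousAutHom b⁻¹)

theorem dualRep_dualVec (g : continuousAut X) (χ : PontryaginDual X) :
    dualRep X g (dualVec X (Additive.ofMul χ)) =
      dualVec X (Additive.ofMul (PontryaginDual.map (continuousAutHom g⁻¹) χ)) :=
  dualMap_dualVec _ _

/-- No power of `g` fixes a nontrivial character. -/
def IsAperiodic (g : continuousAut X) : Prop :=
  ∀ k : ℕ, k ≠ 0 → ∀ χ : PontryaginDual X,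
    PontryaginDual.map (continuousAutHom (g ^ k)) χ = χ → χ = 1

theorem map_continuousAutHom_inv {g : continuousAut X} {χ : PontryaginDual X} :
    PontryaginDual.map (continuousAutHom g⁻¹) χ = χ ↔
      PontryaginDual.map (continuousAutHom g) χ = χ := by
  have key : ∀ g : continuousAut X, PontryaginDual.map (continuousAutHom g) χ = χ →
      PontryaginDual.map (continuousAutHom g⁻¹) χ = χ := by
    intro g h
    refine PontryaginDual.ext fun x => ?_
    have h1 : χ ((g : MulAut X) (((g⁻¹ : continuousAut X) : MulAut X) x)) =
        χ (((g⁻¹ : continuousAut X) : MulAut X) x) :=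
      DFunLike.congr_fun h (((g⁻¹ : continuousAut X) : MulAut X) x)
    rw [Subgroup.coe_inv, MulAut.apply_inv_self] at h1
    exact h1.symm
  exact ⟨fun h => inv_inv g ▸ key g⁻¹ h, key g⟩

theorem dualMap_fixed_iff [ConnectedSpace X] {f : X →ₜ* X} :
    (∀ χ : PontryaginDual X, PontryaginDual.map f χ = χ → χ = 1) ↔
      ∀ v, dualMap f v = v → v = 0 := by
  constructor
  · intro hf v hv
    obtain ⟨s, hs, χ, hχ⟩ := exists_smul_eq_dualVec v
    have h1 : dualMap f (s • v) = s • v := by rw [map_zsmul, hv]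
    rw [hχ, dualMap_dualVec, ← sub_eq_zero, ← map_sub, ← ofMul_div, dualVec_eq_zero_iff,
      div_eq_one] at h1
    rw [hf χ h1, ofMul_one, map_zero] at hχ
    exact DualSpace.eq_zero_of_zsmul_eq_zero hs hχ
  · intro h χ hχ
    rw [← dualVec_eq_zero_iff]
    exact h _ (by rw [dualMap_dualVec, hχ])

theorem isAperiodic_iff [ConnectedSpace X] {g : continuousAut X} :
    IsAperiodic g ↔ ∀ k : ℕ, k ≠ 0 → ∀ v, dualRep X (g ^ k) v = v → v = 0 :=
  forall₂_congr fun k _ => Iff.trans (by simp only [map_continuousAutHom_inv])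
    (dualMap_fixed_iff (f := continuousAutHom (g ^ k)⁻¹))

end DualSpace

/-! ### Aperiodic automorphisms are mixing of all orders -/

section Mixing

variable {X : Type*} [CommGroup X] [TopologicalSpace X] [IsTopologicalGroup X] [CompactSpace X]
  [MeasurableSpace X] [BorelSpace X]

theorem MonoidHom.measurePreserving_normalizedHaar {f : X →* X} (hf : Continuous f)
    (hs : Function.Surjective f) :
    MeasurePreserving f (normalizedHaar X) (normalizedHaar X) :=
  f.measurePreserving hf hs (by rw [measure_univ])

theorem continuousAut.measurePreserving (g : continuousAut X) :
    MeasurePreserving (g : MulAut X) (normalizedHaar X) (normalizedHaar X) :=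
  MonoidHom.measurePreserving_normalizedHaar (f := (g : MulAut X).toMonoidHom) g.2.1
    (g : MulAut X).surjective

/-- The integrand is a single character whose vector in the dual space is a sum of translates under
powers of g. That sum is nonzero for separated exponents, so the character is nontrivial. -/
theorem exists_forall_integral_prod_eq_zero [T2Space X] [ConnectedSpace X]
    [FiniteDimensional ℚ (DualSpace X)] {g : continuousAut X}
    (hg : IsAperiodic g) {κ : Type*} [Fintype κ] {χ : κ → PontryaginDual X} (hχ : ∃ k, χ k ≠ 1) :
    ∃ M : ℤ, ∀ n : κ → ℤ, (∀ i j, i ≠ j → M ≤ |n i - n j|) →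
      ∫ x, ∏ k, dualChar X (χ k) (((g ^ n k : continuousAut X) : MulAut X) x)
        ∂(normalizedHaar X) = 0 := by
  have hg' := isAperiodic_iff.mp hg
  obtain ⟨M, hM⟩ := exists_forall_sum_zpow_ne_zero
    ((dualRep X).comp (zpowersHom (continuousAut X) g)) (g := Multiplicative.ofAdd 1)
    (fun k hk v hv => hg' k hk v (by simpa using hv))
    (u := fun k => dualVec X (Additive.ofMul (χ k)))
    (hχ.imp fun k hk h => hk (dualVec_eq_zero_iff.mp h))
  refine ⟨M, fun n hn => ?_⟩
  -- The exponents change sign because `dualRep` acts through inverses.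
  have h1 := hM (fun k => -n k) fun i j hij => by
    rw [neg_sub_neg, abs_sub_comm]; exact hn i j hij
  have h2 : ∀ k, ((dualRep X).comp (zpowersHom (continuousAut X) g))
      (Multiplicative.ofAdd 1 ^ (-n k)) (dualVec X (Additive.ofMul (χ k))) =
        dualVec X (Additive.ofMul (PontryaginDual.map (continuousAutHom (g ^ n k)) (χ k))) := by
    intro k
    rw [MonoidHom.comp_apply, map_zpow, zpowersHom_apply, toAdd_ofAdd, zpow_one, dualRep_dualVec,
      zpow_neg, inv_inv]
  simp only [h2] at h1
  rw [← map_sum, ← ofMul_prod, Ne, dualVec_eq_zero_iff] at h1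
  rw [← integral_dualChar h1]
  refine integral_congr_ae (.of_forall fun x => ?_)
  simp only [map_prod, ContinuousMap.prod_apply]
  rfl

/-- Powers of an aperiodic automorphism become independent as the exponents move apart. -/
theorem IsAperiodic.tendsto_measure_iInter [T2Space X] [ConnectedSpace X]
    [FiniteDimensional ℚ (DualSpace X)] {g : continuousAut X}
    (hg : IsAperiodic g) {ι κ : Type*} [Fintype κ] {l : Filter ι} {N : ι → κ → ℤ}
    (hN : ∀ M : ℤ, ∀ j k, j ≠ k → ∀ᶠ i in l, M ≤ |N i j - N i k|) {B : κ → Set X}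
    (hB : ∀ k, NullMeasurableSet (B k) (normalizedHaar X)) :
    Tendsto (fun i => normalizedHaar X
      (⋂ k, ((g ^ N i k : continuousAut X) : MulAut X) ⁻¹' B k)) l
      (𝓝 (∏ k, normalizedHaar X (B k))) := by
  refine tendsto_measure_iInter_preimage_of_dualChar
    (T := fun i k => ((g ^ N i k : continuousAut X) : MulAut X))
    (fun i k => continuousAut.measurePreserving _) (fun χ hχ => ?_) hB
  obtain ⟨M, hM⟩ := exists_forall_integral_prod_eq_zero hg hχ
  have h : ∀ᶠ i in l, ∀ j k, j ≠ k → M ≤ |N i j - N i k| := by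
    simp only [eventually_all]
    exact hN M
  exact h.mono fun i hi => hM _ hi

theorem IsAperiodic.isMixingElement [T2Space X] [ConnectedSpace X]
    [FiniteDimensional ℚ (DualSpace X)] {g : continuousAut X}
    (hg : IsAperiodic g) : IsMixingElement (g : MulAut X) := by
  intro s _ B hB
  have h := hg.tendsto_measure_iInter (N := fun (n : Fin s → ℕ) k => (n k : ℤ))
    (l := ⨅ (i : Fin s) (j : Fin s) (_ : i ≠ j),
        comap (fun n : Fin s → ℕ => |(n i : ℤ) - (n j : ℤ)|) atTop) ?_ hB
  · simpa only [zpow_natCast, Subgroup.coe_pow] using h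
  · intro M j k hjk
    have : Tendsto (fun n : Fin s → ℕ => |(n j : ℤ) - (n k : ℤ)|)
        (⨅ (i : Fin s) (j : Fin s) (_ : i ≠ j),
          comap (fun n : Fin s → ℕ => |(n i : ℤ) - (n j : ℤ)|) atTop) atTop :=
      tendsto_iff_comap.mpr (iInf_le_of_le j (iInf_le_of_le k (iInf_le _ hjk)))
    exact this.eventually_ge_atTop M

theorem blockProd_zero_add {G : Type*} [Semigroup G] (γ : ℕ → G) (j n : ℕ) :
    blockProd γ 0 (j + n + 1) = blockProd γ (j + 1) n * blockProd γ 0 j := by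
  induction n with
  | zero => simp [blockProd]
  | succ n ih =>
    rw [← add_assoc, blockProd, ih, ← mul_assoc, blockProd]
    congr 3
    omega

/-- In a cyclic group the block products are powers of g whose exponents are the differences of
those of the partial products, so their tending to infinity separates the latter. -/
theorem IsAperiodic.isMixingOfAllOrders [T2Space X] [ConnectedSpace X]
    [FiniteDimensional ℚ (DualSpace X)] {g : continuousAut X}
    (hg : IsAperiodic g) : IsMixingOfAllOrders (Subgroup.zpowers (g : MulAut X)) := by
  refine ⟨fun hX => ?_, fun s _ B hB => ?_⟩
  · rw [← not_finite_iff_infinite]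
    intro hfin
    obtain ⟨x, hx⟩ := exists_ne (1 : X)
    obtain ⟨χ, hχ⟩ := exists_pontryaginDual_apply_ne_one hx
    obtain ⟨k, hk, hk1⟩ := (isOfFinOrder_iff_pow_eq_one).mp
      (finite_zpowers.mp (Set.toFinite _) : IsOfFinOrder (g : MulAut X))
    have h1 : g ^ k = 1 := Subtype.ext hk1
    refine hχ ?_
    rw [hg k hk.ne' χ (by rw [h1]; rfl)]
    rfl
  · choose m hm using fun a : Subgroup.zpowers (g : MulAut X) => Subgroup.mem_zpowers_iff.mp a.2
    have h := hg.tendsto_measure_iInter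
      (N := fun (γ : ℕ → Subgroup.zpowers (g : MulAut X)) (k : Fin s) => m (blockProd γ 0 k))
      (l := ⨅ (i : ℕ) (n : ℕ) (_ : 0 < i ∧ i + n < s),
        comap (fun γ : ℕ → Subgroup.zpowers (g : MulAut X) => blockProd γ i n) cofinite)
      (B := fun k => B k) ?_ (fun k => hB k)
    · rw [Finset.prod_range]
      convert h using 3 with γ
      ext x
      simp only [Set.mem_iInter, Finset.mem_range, Set.mem_preimage, Subgroup.coe_zpow, hm]
      exact ⟨fun h k => h k k.2, fun h k hk => h ⟨k, hk⟩⟩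
    · intro M
      have key : ∀ j k : Fin s, j < k → ∀ᶠ γ in ⨅ (i : ℕ) (n : ℕ) (_ : 0 < i ∧ i + n < s),
          comap (fun γ : ℕ → Subgroup.zpowers (g : MulAut X) => blockProd γ i n) cofinite,
          M ≤ |m (blockProd γ 0 k) - m (blockProd γ 0 j)| := by
        intro j k hjk
        obtain ⟨n, hn⟩ := Nat.exists_eq_add_of_lt (Fin.lt_def.mp hjk)
        have ht : Tendsto (fun γ : ℕ → Subgroup.zpowers (g : MulAut X) => blockProd γ (j + 1) n)
            (⨅ (i : ℕ) (n : ℕ) (_ : 0 < i ∧ i + n < s),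
              comap (fun γ : ℕ → Subgroup.zpowers (g : MulAut X) => blockProd γ i n) cofinite)
            cofinite :=
          tendsto_iff_comap.mpr (iInf_le_of_le (j + 1 : ℕ) (iInf_le_of_le n
            (iInf_le _ ⟨Nat.succ_pos _, by have := k.2; omega⟩)))
        -- Only finitely many elements have an exponent of absolute value below M, so the block
        -- product eventually avoids them.
        have hfin : {a : Subgroup.zpowers (g : MulAut X) |
            ∃ c ∈ Set.Ioo (-M) M, a = (⟨g, Subgroup.mem_zpowers _⟩ : Subgroup.zpowers
              (g : MulAut X)) ^ c}.Finite :=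
          ((Set.finite_Ioo (-M) M).image fun c => (⟨g, Subgroup.mem_zpowers _⟩ :
            Subgroup.zpowers (g : MulAut X)) ^ c).subset
            (by rintro a ⟨c, hc, rfl⟩; exact ⟨c, hc, rfl⟩)
        filter_upwards [ht.eventually hfin.compl_mem_cofinite] with γ hγ
        by_contra! hlt
        refine hγ ⟨_, abs_lt.mp hlt, Subtype.ext ?_⟩
        rw [hn, Subgroup.coe_zpow, zpow_sub, hm, hm, blockProd_zero_add, Subgroup.coe_mul,
          mul_inv_cancel_right]
      intro j k hjk
      rcases lt_or_gt_of_ne hjk with h | h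
      · simpa only [abs_sub_comm] using key j k h
      · exact key k j h

end Mixing

/-! ### Mixing forces aperiodicity -/

section Converse

variable {X : Type*} [CommGroup X] [TopologicalSpace X] [IsTopologicalGroup X] [CompactSpace X]
  [MeasurableSpace X] [BorelSpace X]

section

variable {X : Type*} [CommGroup X] [TopologicalSpace X]

theorem continuous_re_dualChar (χ : PontryaginDual X) :
    Continuous fun x => (dualChar X χ x).re :=
  Complex.continuous_re.comp (dualChar X χ).continuous

theorem preimage_re_dualChar_pos {g : continuousAut X} {χ : PontryaginDual X}
    (h : PontryaginDual.map (continuousAutHom g) χ = χ) :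
    (g : MulAut X) ⁻¹' {x | 0 < (dualChar X χ x).re} = {x | 0 < (dualChar X χ x).re} := by
  ext x
  have h1 : χ ((g : MulAut X) x) = χ x := DFunLike.congr_fun h x
  simp only [Set.mem_preimage, Set.mem_ofPred_eq, dualChar_apply, h1]

theorem map_continuousAutHom_pow_of_eq {g : continuousAut X} {χ : PontryaginDual X}
    (h : PontryaginDual.map (continuousAutHom g) χ = χ) (i : ℕ) :
    PontryaginDual.map (continuousAutHom (g ^ i)) χ = χ := by
  induction i with
  | zero => rfl
  | succ i ih =>
    have : PontryaginDual.map (continuousAutHom (g ^ i * g)) χ =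
      PontryaginDual.map (continuousAutHom g)
        (PontryaginDual.map (continuousAutHom (g ^ i)) χ) := rfl
    rw [pow_succ, this, ih, h]

end

theorem integral_re_dualChar {χ : PontryaginDual X} (hχ : χ ≠ 1) :
    ∫ x, (dualChar X χ x).re ∂(normalizedHaar X) = 0 := by
  have h := integral_re (𝕜 := ℂ) (μ := normalizedHaar X) (f := fun x => dualChar X χ x)
    ((dualChar X χ).continuous.integrable_of_hasCompactSupport
        (HasCompactSupport.of_compactSpace _))
  rw [integral_dualChar hχ] at h
  simpa using h

/-- This set is the witness against mixing: Re χ has mean zero and is 1 at the identity, so the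
measure is neither 0 nor 1. Invariance under infinitely many transformations would make it equal to
its square. -/
theorem measure_re_dualChar_pos_mul_self_ne {χ : PontryaginDual X} (hχ : χ ≠ 1) :
    normalizedHaar X {x | 0 < (dualChar X χ x).re} * normalizedHaar X {x | 0 < (dualChar X χ x).re}
      ≠ normalizedHaar X {x | 0 < (dualChar X χ x).re} := by
  obtain ⟨h0, h1⟩ := measure_pos_ne_zero_ne_one (continuous_re_dualChar χ)
    (integral_re_dualChar hχ) (x₀ := 1) (by rw [dualChar_apply, map_one]; simp)
  intro h
  refine h1 ((ENNReal.mul_eq_left h0 (measure_ne_top _ _)).mp h)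

theorem nullMeasurableSet_re_dualChar_pos (χ : PontryaginDual X) :
    NullMeasurableSet {x | 0 < (dualChar X χ x).re} (normalizedHaar X) :=
  (isOpen_lt continuous_const (continuous_re_dualChar χ)).measurableSet.nullMeasurableSet

/-- If g ^ k fixes χ, mixing of order two is contradicted along the exponents 0 and k * i. -/
theorem IsMixingElement.isAperiodic {g : continuousAut X} (hg : IsMixingElement (g : MulAut X)) :
    IsAperiodic g := by
  intro k hk χ hχ
  by_contra h1
  have h := (hg 2 one_le_two (fun _ => {x | 0 < (dualChar X χ x).re})
    fun _ => nullMeasurableSet_re_dualChar_pos χ).comp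
      (x := atTop) (f := fun (i : ℕ) => ![0, k * i]) ?_
  · have hc : ∀ i : ℕ, ⋂ j, ((g : MulAut X) ^ (![0, k * i] : Fin 2 → ℕ) j) ⁻¹'
        {x | 0 < (dualChar X χ x).re} = {x | 0 < (dualChar X χ x).re} := by
      intro i
      have h2 := preimage_re_dualChar_pos (map_continuousAutHom_pow_of_eq hχ i)
      rw [← pow_mul, Subgroup.coe_pow] at h2
      ext x
      rw [Set.mem_iInter, Fin.forall_fin_two]
      simp only [Matrix.cons_val_zero, Matrix.cons_val_one, h2, pow_zero]
      exact and_self_iff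
    simp only [Function.comp_def, hc] at h
    rw [tendsto_const_nhds_iff, Fin.prod_univ_two] at h
    exact measure_re_dualChar_pos_mul_self_ne h1 h.symm
  · simp only [tendsto_iInf, tendsto_comap_iff]
    have ht : Tendsto (fun i : ℕ => ((k * i : ℕ) : ℤ)) atTop atTop :=
      tendsto_natCast_atTop_atTop.comp (tendsto_id.const_mul_atTop' (Nat.pos_of_ne_zero hk))
    intro i j hij
    fin_cases i <;> fin_cases j
    · exact absurd rfl hij
    · simpa [Function.comp_def] using ht
    · simpa [Function.comp_def] using ht
    · exact absurd rfl hij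

theorem IsMixingOfOrder.finite_setOf_map_eq {Λ : Subgroup (MulAut X)} (hΛ : Λ ≤ continuousAut X)
    (h : IsMixingOfOrder Λ 2) {χ : PontryaginDual X} (hχ : χ ≠ 1) :
    {a : Λ | PontryaginDual.map (continuousAutHom (Subgroup.inclusion hΛ a)) χ = χ}.Finite := by
  set S := {a : Λ | PontryaginDual.map (continuousAutHom (Subgroup.inclusion hΛ a)) χ = χ} with hS
  by_contra hinf
  have : NeBot (cofinite ⊓ 𝓟 S) := cofinite_inf_principal_neBot_iff.mpr hinf
  have ht := (h (fun _ => {x | 0 < (dualChar X χ x).re})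
    fun _ => nullMeasurableSet_re_dualChar_pos χ).comp
      -- With this sequence the partial products are 1 and a; for order two the only block product
      -- required to tend to infinity is a itself.
      (x := cofinite ⊓ 𝓟 S) (f := fun (a : Λ) (i : ℕ) => if i = 1 then a else 1) ?_
  · have hc : (fun a : Λ => normalizedHaar X (⋂ k ∈ Finset.range 2,
        ((blockProd (fun i : ℕ => if i = 1 then a else 1) 0 k : Λ) : MulAut X) ⁻¹'
          {x | 0 < (dualChar X χ x).re})) =ᶠ[cofinite ⊓ 𝓟 S]
        fun _ => normalizedHaar X {x | 0 < (dualChar X χ x).re} := by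
      filter_upwards [mem_inf_of_right (mem_principal_self S)] with a ha
      have h2 : ((a : MulAut X)) ⁻¹' {x | 0 < (dualChar X χ x).re} =
        {x | 0 < (dualChar X χ x).re} := preimage_re_dualChar_pos ha
      congr 1
      ext x
      simp only [Set.mem_iInter, Finset.mem_range, Nat.forall_lt_succ_right, Nat.not_lt_zero,
        IsEmpty.forall_iff, implies_true, true_and]
      simp [blockProd, h2]
    have h3 := tendsto_nhds_unique (ht.congr' hc) tendsto_const_nhds
    rw [Finset.prod_const, Finset.card_range, sq] at h3
    exact measure_re_dualChar_pos_mul_self_ne hχ h3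
  · simp only [tendsto_iInf, tendsto_comap_iff]
    rintro i n ⟨hi, hin⟩
    obtain rfl : i = 1 := by omega
    obtain rfl : n = 0 := by omega
    exact tendsto_inf_left tendsto_id

/-- Mixing makes the stabilizer of each nontrivial character finite, so a virtually fixed vector
would make Λ finite. Otherwise take a outside the infinite-index subgroup: were a ^ k to fix a
nontrivial character, its powers would lie in a finite set, so a would have finite order, whereas no
positive power of a fixes a nonzero vector of W. -/
theorem IsMixingOfAllOrders.exists_isAperiodic [T2Space X] [ConnectedSpace X]
    [FiniteDimensional ℚ (DualSpace X)] {Λ : Subgroup (MulAut X)} (hΛ : Λ ≤ continuousAut X)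
    (hcomm : ∀ a ∈ Λ, ∀ b ∈ Λ, a * b = b * a) (h : IsMixingOfAllOrders Λ) :
    ∃ g : continuousAut X, (g : MulAut X) ∈ Λ ∧ IsAperiodic g := by
  rcases subsingleton_or_nontrivial X with hX | hX
  · exact ⟨1, Λ.one_mem, fun k _ χ _ => PontryaginDual.ext fun x => by
      rw [Subsingleton.elim x 1, map_one, map_one]⟩
  have hinf : Infinite Λ := h.1 hX
  have hfin := fun χ (hχ : χ ≠ 1) => (h.2 2 one_le_two).finite_setOf_map_eq hΛ hχ
  obtain ⟨x, hx⟩ := exists_ne (1 : X)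
  obtain ⟨χ₀, hχ₀⟩ := exists_pontryaginDual_apply_ne_one hx
  have hnt : Nontrivial (DualSpace X) := nontrivial_of_ne (dualVec X (Additive.ofMul χ₀)) 0
    fun h => hχ₀ (by rw [dualVec_eq_zero_iff.mp h]; rfl)
  have hsolv : Group.IsSolvable Λ :=
    Group.isSolvable_of_comm fun a b => Subtype.ext (hcomm a a.2 b b.2)
  rcases exists_virtually_fixed_or_exists_infinite_index
    ((dualRep X).comp (Subgroup.inclusion hΛ)) with ⟨D, hD, v, hv, hfix⟩ |
      ⟨D, hD, W, hW, -, H, hH, hfix⟩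
  · exfalso
    obtain ⟨s, hs, χ, hχ⟩ := exists_smul_eq_dualVec v
    have hχ1 : χ ≠ 1 := by
      rintro rfl
      rw [ofMul_one, map_zero] at hχ
      exact hv (DualSpace.eq_zero_of_zsmul_eq_zero hs hχ)
    have hDfin : (D : Set Λ).Finite := by
      refine (hfin χ hχ1).subset fun a ha => ?_
      have h1 : dualRep X (Subgroup.inclusion hΛ a) (s • v) = s • v := by
        rw [map_zsmul]; exact congrArg _ (hfix a ha)
      rw [hχ, dualRep_dualVec, ← sub_eq_zero, ← map_sub, ← ofMul_div, dualVec_eq_zero_iff,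
        div_eq_one, map_continuousAutHom_inv] at h1
      exact h1
    have : Finite D := hDfin
    exact not_finite_iff_infinite.mpr hinf (D.finite_iff_finite_and_finiteIndex.mpr ⟨this, hD⟩)
  · obtain ⟨a, haD, haH⟩ := exists_mem_forall_notMem_of_not_finiteIndex hD {H} (by simpa using hH)
    refine ⟨Subgroup.inclusion hΛ a, a.2, fun k hk χ hχ => ?_⟩
    by_contra hχ1
    have h1 : IsOfFinOrder (a ^ k) := by
      refine finite_powers.mp ((hfin χ hχ1).subset ?_)
      rintro _ ⟨i, rfl⟩
      exact map_continuousAutHom_pow_of_eq hχ i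
    obtain ⟨m, hm, hm1⟩ := isOfFinOrder_iff_pow_eq_one.mp
        (isOfFinOrder_pow.mp h1 |>.resolve_right hk)
    obtain ⟨w, hw, hw0⟩ := W.ne_bot_iff.mp hW
    exact hw0 (hfix a haD (haH H (Finset.mem_singleton_self H)) m hm.ne' w hw
      (by rw [hm1, map_one]; rfl))

end Converse

/-! ### Restriction to closed connected subgroups -/

section Restriction

variable {X : Type*} [CommGroup X] [TopologicalSpace X]

/-- The restriction of a continuous automorphism to an invariant subgroup. -/
def restrictAut (g : continuousAut X) (Y : Subgroup X) (h : ∀ y ∈ Y, (g : MulAut X) y ∈ Y)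
    (h' : ∀ y ∈ Y, (g : MulAut X)⁻¹ y ∈ Y) : continuousAut Y where
  val :=
    { toFun y := ⟨(g : MulAut X) y, h y y.2⟩
      invFun y := ⟨(g : MulAut X)⁻¹ y, h' y y.2⟩
      left_inv _ := Subtype.ext (MulAut.inv_apply_self _ _ _)
      right_inv _ := Subtype.ext (MulAut.apply_inv_self _ _ _)
      map_mul' _ _ := Subtype.ext (map_mul _ _ _) }
  property := ⟨(g.2.1.comp continuous_subtype_val).subtype_mk _,
    (g.2.2.comp continuous_subtype_val).subtype_mk _⟩

theorem coe_restrictAut_apply {g : continuousAut X} {Y : Subgroup X}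
    (h : ∀ y ∈ Y, (g : MulAut X) y ∈ Y) (h' : ∀ y ∈ Y, (g : MulAut X)⁻¹ y ∈ Y) (y : Y) :
    (((restrictAut g Y h h' : continuousAut Y) : MulAut Y) y : X) = (g : MulAut X) y := rfl

theorem coe_restrictAut_pow_apply {g : continuousAut X} {Y : Subgroup X}
    (h : ∀ y ∈ Y, (g : MulAut X) y ∈ Y) (h' : ∀ y ∈ Y, (g : MulAut X)⁻¹ y ∈ Y) (k : ℕ) (y : Y) :
    (((restrictAut g Y h h' ^ k : continuousAut Y) : MulAut Y) y : X) =
      ((g ^ k : continuousAut X) : MulAut X) y := by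
  induction k generalizing y with
  | zero => rfl
  | succ k ih =>
    rw [pow_succ, pow_succ, Subgroup.coe_mul, Subgroup.coe_mul, MulAut.mul_apply, MulAut.mul_apply,
      ih, coe_restrictAut_apply]

/-- The inclusion of a subgroup as a continuous homomorphism. -/
def subtypeHom (Y : Subgroup X) : Y →ₜ* X := ⟨Y.subtype, continuous_subtype_val⟩

variable [IsTopologicalGroup X] [CompactSpace X] [T2Space X]

theorem dualMap_subtypeHom_surjective {Y : Subgroup X} (hY : IsClosed (Y : Set X)) :
    Function.Surjective (dualMap (subtypeHom Y)) := by
  intro v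
  obtain ⟨s, hs, ψ, hψ⟩ := exists_smul_eq_dualVec v
  obtain ⟨χ, hχ⟩ := resDual_surjective hY ψ
  refine ⟨(s : ℚ)⁻¹ • dualVec X (Additive.ofMul χ), ?_⟩
  have h1 : PontryaginDual.map (subtypeHom Y) χ = ψ := hχ
  rw [map_smul, dualMap_dualVec, h1, ← hψ, ← Int.cast_smul_eq_zsmul ℚ,
    inv_smul_smul₀ (Int.cast_ne_zero.mpr hs)]

theorem finiteDimensional_dualSpace_subgroup [FiniteDimensional ℚ (DualSpace X)] {Y : Subgroup X}
    (hY : IsClosed (Y : Set X)) : FiniteDimensional ℚ (DualSpace Y) :=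
  Module.Finite.of_surjective _ (dualMap_subtypeHom_surjective hY)

/-- In finite dimension, injectivity of g ^ k - 1 is surjectivity, and surjectivity descends to the
dual space of Y, a quotient of that of X. -/
theorem IsAperiodic.restrict [FiniteDimensional ℚ (DualSpace X)] [ConnectedSpace X]
    {g : continuousAut X} (hg : IsAperiodic g) {Y : Subgroup X} (hY : IsClosed (Y : Set X))
    [ConnectedSpace Y] (h : ∀ y ∈ Y, (g : MulAut X) y ∈ Y)
    (h' : ∀ y ∈ Y, (g : MulAut X)⁻¹ y ∈ Y) : IsAperiodic (restrictAut g Y h h') := by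
  intro k hk
  have := finiteDimensional_dualSpace_subgroup hY
  have hinj := dualMap_fixed_iff.mp (hg k hk)
  set σ := continuousAutHom (restrictAut g Y h h' ^ k)
  rw [dualMap_fixed_iff]
  have hX : Function.Surjective
      (dualMap (continuousAutHom (g ^ k)) - LinearMap.id : Module.End ℚ (DualSpace X)) := by
    rw [← LinearMap.injective_iff_surjective, injective_iff_map_eq_zero]
    exact fun v hv => hinj v (sub_eq_zero.mp hv)
  have hcomm : (dualMap (subtypeHom Y)).comp (dualMap (continuousAutHom (g ^ k))) =
      (dualMap σ).comp (dualMap (subtypeHom Y)) := by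
    rw [← dualMap_comp, ← dualMap_comp]
    congr 1
    ext y
    exact (coe_restrictAut_pow_apply h h' k y).symm
  have hsurj : Function.Surjective (dualMap σ - LinearMap.id : Module.End ℚ (DualSpace Y)) := by
    intro v
    obtain ⟨u, rfl⟩ := dualMap_subtypeHom_surjective hY v
    obtain ⟨w, rfl⟩ := hX u
    refine ⟨dualMap (subtypeHom Y) w, ?_⟩
    have := LinearMap.congr_fun hcomm w
    simp only [LinearMap.comp_apply] at this
    simp only [LinearMap.sub_apply, LinearMap.id_apply, map_sub, this]
  have hinjY := LinearMap.injective_iff_surjective.mpr hsurj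
  exact fun v hv => (injective_iff_map_eq_zero _).mp hinjY v (sub_eq_zero.mpr hv)

end Restriction

/-! ### Hereditary ergodicity and aperiodicity -/

section Ergodicity

variable {X : Type*} [CommGroup X] [TopologicalSpace X] [IsTopologicalGroup X] [CompactSpace X]
  [MeasurableSpace X] [BorelSpace X]

/-- Mixing of order two applied to A twice gives m(A) = m(A)². -/
theorem IsAperiodic.measure_eq_zero_or_one [T2Space X] [ConnectedSpace X]
    [FiniteDimensional ℚ (DualSpace X)] {g : continuousAut X} (hg : IsAperiodic g) {A : Set X}
    (hA : NullMeasurableSet A (normalizedHaar X)) (hinv : (g : MulAut X) ⁻¹' A = A) :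
    normalizedHaar X A = 0 ∨ normalizedHaar X A = 1 := by
  have hpow : ∀ i : ℕ, ((g ^ i : continuousAut X) : MulAut X) ⁻¹' A = A := by
    intro i
    induction i with
    | zero => rfl
    | succ i ih =>
      rw [pow_succ, Subgroup.coe_mul, MulAut.coe_mul, Set.preimage_comp, ih, hinv]
  have h := hg.tendsto_measure_iInter (κ := Fin 2) (N := fun (i : ℕ) => ![0, (i : ℤ)]) (l := atTop)
    (B := fun _ => A) ?_ (fun _ => hA)
  · have hc : ∀ i : ℕ, ⋂ j, ((g ^ (![0, (i : ℤ)] : Fin 2 → ℤ) j : continuousAut X) : MulAut X) ⁻¹'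
        A = A := by
      intro i
      ext x
      rw [Set.mem_iInter, Fin.forall_fin_two]
      have h2 := hpow i
      simp only [Matrix.cons_val_zero, Matrix.cons_val_one, zpow_natCast, h2, zpow_zero]
      exact and_self_iff
    simp only [hc] at h
    rw [tendsto_const_nhds_iff, Fin.prod_univ_two] at h
    by_cases h0 : normalizedHaar X A = 0
    · exact .inl h0
    · exact .inr ((ENNReal.mul_eq_left h0 (measure_ne_top _ _)).mp h.symm)
  · intro M i j hij
    have ht : ∀ᶠ i : ℕ in atTop, M ≤ (i : ℤ) := tendsto_natCast_atTop_atTop.eventually_ge_atTop M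
    fin_cases i <;> fin_cases j
    · exact absurd rfl hij
    · simpa using ht
    · simpa using ht
    · exact absurd rfl hij

/-- Finite index puts a power of g into Γ_Y; it is still aperiodic, and so is its restriction to Y.
-/
theorem IsAperiodic.isHereditarilyErgodic [T2Space X] [ConnectedSpace X]
    [FiniteDimensional ℚ (DualSpace X)] {g : continuousAut X} (hg : IsAperiodic g)
    {Γ : Subgroup (MulAut X)} (hgΓ : (g : MulAut X) ∈ Γ) : IsHereditarilyErgodic Γ := by
  rintro Y hY hYc ⟨Δ, hΔ, hΔi⟩ A hA hinv
  have : CompactSpace Y := isCompact_iff_compactSpace.mp hY.isCompact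
  have : ConnectedSpace Y := isConnected_iff_connectedSpace.mp hYc
  have := finiteDimensional_dualSpace_subgroup hY
  obtain ⟨k, hk, hkΔ⟩ : ∃ k ≠ 0, (g : MulAut X) ^ k ∈ Δ := by
    obtain ⟨k, hk, -, hmem⟩ := Subgroup.exists_pow_mem_of_index_ne_zero hΔi ⟨g, hgΓ⟩
    exact ⟨k, hk.ne', hmem⟩
  have hΔ' : ∀ a, a ∈ Δ ↔ a ∈ stabPart Γ Y := fun a => by rw [← hΔ]; rfl
  have hgk : IsAperiodic (g ^ k) := fun j hj => by
    rw [← pow_mul]; exact hg _ (mul_ne_zero hk hj)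
  have h1 := ((hΔ' _).mp hkΔ).2
  refine (hgk.restrict hY h1 ((hΔ' _).mp (inv_mem hkΔ)).2).measure_eq_zero_or_one hA ?_
  exact hinv _ ⟨_, (hΔ' _).mp hkΔ, fun y => rfl⟩

/-- The real part of the sum of the characters in O is invariant, has mean zero and is positive at
1, so its positivity set is a nontrivial invariant set. -/
theorem not_isErgodicFamily_of_bijOn {F : Set (X → X)} {O : Finset (PontryaginDual X)}
    (hO : O.Nonempty) (hO1 : 1 ∉ O)
    (hF : ∀ T ∈ F, ∃ f : X →ₜ* X, ⇑f = T ∧ Set.BijOn (PontryaginDual.map f) O O) :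
    ¬ IsErgodicFamily (normalizedHaar X) F := by
  intro herg
  have hcont : Continuous fun x => ∑ ψ ∈ O, (dualChar X ψ x).re :=
    continuous_finsetSum _ fun ψ _ => continuous_re_dualChar ψ
  obtain ⟨h0, h1⟩ := measure_pos_ne_zero_ne_one hcont (x₀ := 1) (by
    rw [integral_finsetSum _ fun ψ _ => (continuous_re_dualChar ψ).integrable_of_hasCompactSupport
      (HasCompactSupport.of_compactSpace _)]
    exact Finset.sum_eq_zero fun ψ hψ => integral_re_dualChar fun h => hO1 (h ▸ hψ)) (by
    simpa [dualChar_apply] using hO)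
  refine (herg _ (isOpen_lt continuous_const hcont).measurableSet.nullMeasurableSet ?_).elim h0 h1
  intro T hT
  obtain ⟨f, rfl, hf⟩ := hF T hT
  ext x
  have hsum : ∑ ψ ∈ O, (dualChar X ψ (f x)).re = ∑ ψ ∈ O, (dualChar X ψ x).re :=
    Finset.sum_nbij (PontryaginDual.map f) hf.mapsTo hf.injOn hf.surjOn fun ψ _ => rfl
  simp only [Set.mem_preimage, Set.mem_ofPred_eq, hsum]

/-- The annihilator Y of the characters in W is closed, connected and virtually invariant. A
character fixed by D modulo W has a finite orbit under Γ_Y when restricted to Y, so ergodicity makes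
the restriction trivial, and the double annihilator theorem puts the character in W. -/
theorem IsHereditarilyErgodic.dualVec_mem [T2Space X] {Γ : Subgroup (MulAut X)}
    (hΓ : Γ ≤ continuousAut X) (h : IsHereditarilyErgodic Γ) {W : Submodule ℚ (DualSpace X)}
    {D : Subgroup Γ} (hD : D.FiniteIndex)
    (hW : ∀ g ∈ D, ∀ w ∈ W, dualRep X (Subgroup.inclusion hΓ g) w ∈ W) {χ : PontryaginDual X}
    (hχ : ∀ g ∈ D, dualRep X (Subgroup.inclusion hΓ g) (dualVec X (Additive.ofMul χ)) -
      dualVec X (Additive.ofMul χ) ∈ W) : dualVec X (Additive.ofMul χ) ∈ W := by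
  classical
  let B : Subgroup (PontryaginDual X) :=
    Subgroup.toAddSubgroup.symm (W.toAddSubgroup.comap (dualVec X).toAddMonoidHom)
  have hB : ∀ ψ, ψ ∈ B ↔ dualVec X (Additive.ofMul ψ) ∈ W := fun ψ => Iff.rfl
  let Y := dualAnnihilator B
  have hY : IsClosed (Y : Set X) := isClosed_dualAnnihilator B
  have : CompactSpace Y := isCompact_iff_compactSpace.mp hY.isCompact
  have hBY : ∀ ψ : PontryaginDual X, (∀ y ∈ Y, ψ y = 1) → ψ ∈ B :=
    fun ψ hψ => mem_of_forall_dualAnnihilator hψ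
  -- The dual of Y is torsion-free because W is a rational subspace: φ ^ n in B implies φ in B.
  have : ConnectedSpace Y := by
    refine connectedSpace_of_dual_torsionFree fun ψ n hn hψ => ?_
    obtain ⟨φ, rfl⟩ := resDual_surjective hY ψ
    rw [← map_pow] at hψ
    have h1 : φ ^ n ∈ B := hBY _ fun y hy => DFunLike.congr_fun hψ (⟨y, hy⟩ : Y)
    rw [hB, ofMul_pow, map_nsmul, ← Nat.cast_smul_eq_nsmul ℚ,
      Submodule.smul_mem_iff _ (Nat.cast_ne_zero.mpr hn), ← hB] at h1
    exact PontryaginDual.ext fun y => mem_dualAnnihilator.mp y.2 φ h1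
  have hDY : ∀ g ∈ D, ∀ y ∈ Y, (g : MulAut X) y ∈ Y := by
    intro g hg y hy
    rw [mem_dualAnnihilator]
    intro ψ hψ
    have h1 := hW g⁻¹ (inv_mem hg) _ ((hB ψ).mp hψ)
    rw [map_inv, dualRep_dualVec, inv_inv, ← hB] at h1
    exact mem_dualAnnihilator.mp hy _ h1
  have hpow : ∀ {g : MulAut X}, (∀ y ∈ Y, g y ∈ Y) → ∀ k : ℕ, ∀ y ∈ Y, (g ^ k) y ∈ Y := by
    intro g hg k
    induction k with
    | zero => exact fun y hy => hy
    | succ k ih => exact fun y hy => by rw [pow_succ]; exact ih _ (hg y hy)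
  let Δ : Subgroup (MulAut X) :=
    { carrier := stabPart Γ Y
      one_mem' := ⟨Γ.one_mem, fun y hy => hy⟩
      mul_mem' := fun {a b} ha hb => ⟨mul_mem ha.1 hb.1, fun y hy => ha.2 _ (hb.2 y hy)⟩
      inv_mem' := by
        rintro a ⟨haΓ, ha⟩
        refine ⟨inv_mem haΓ, ?_⟩
        obtain ⟨k, hk, -, hmem⟩ := Subgroup.exists_pow_mem_of_index_ne_zero hD.index_ne_zero
          (⟨a, haΓ⟩ : Γ)
        intro y hy
        -- The condition a Y ⊆ Y does not by itself pass to inverses; but some a ^ k with k > 0 lies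
        -- in D, a group preserving Y.
        have h1 : a⁻¹ = a ^ (k - 1) * (a ^ k)⁻¹ := by
          obtain ⟨k, rfl⟩ := Nat.exists_eq_succ_of_ne_zero hk.ne'
          rw [Nat.succ_sub_one, pow_succ', mul_inv_rev, mul_inv_cancel_left]
        rw [h1]
        exact hpow ha _ _ (hDY _ (inv_mem hmem) y hy) }
  have hDΔ : D ≤ Δ.subgroupOf Γ := fun g hg => ⟨g.2, hDY g hg⟩
  have herg := h Y hY (isConnected_iff_connectedSpace.mpr ‹_›)
    ⟨Δ, rfl, (Subgroup.finiteIndex_of_le hDΔ).index_ne_zero⟩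
  by_contra hχW
  let r : Γ → PontryaginDual Y := fun g =>
    resDual Y (PontryaginDual.map (continuousAutHom (Subgroup.inclusion hΓ g⁻¹)) χ)
  have hr : ∀ (g : Γ) (y : Y), r g y = χ ((g : MulAut X)⁻¹ y) := fun g y => rfl
  -- The translates of χ restricted to Y depend only on the coset of D, so the finite index of D
  -- makes the orbit finite.
  have hrD : ∀ g : Γ, g ∈ Δ.subgroupOf Γ → ∀ d ∈ D, r (g * d) = r g := by
    intro g hg d hd
    have h1 := hχ d hd
    rw [dualRep_dualVec, ← map_sub, ← ofMul_div, ← hB] at h1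
    refine PontryaginDual.ext fun y => ?_
    have h2 := mem_dualAnnihilator.mp ((inv_mem hg : g⁻¹ ∈ Δ.subgroupOf Γ).2 y y.2) _ h1
    rw [hr, hr, Subgroup.coe_mul, mul_inv_rev]
    exact div_eq_one.mp h2
  have hfin : (r '' (Δ.subgroupOf Γ)).Finite := by
    refine (Set.finite_range fun q : Γ ⧸ D => r q.out).subset ?_
    rintro _ ⟨g, hg, rfl⟩
    have hd : (QuotientGroup.mk g : Γ ⧸ D).out⁻¹ * g ∈ D :=
      QuotientGroup.eq.mp (QuotientGroup.out_eq' _)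
    refine ⟨QuotientGroup.mk g, ?_⟩
    have ho : (QuotientGroup.mk g : Γ ⧸ D).out ∈ Δ.subgroupOf Γ := by
      have := mul_mem hg (inv_mem (hDΔ hd))
      rwa [mul_inv_rev, inv_inv, mul_inv_cancel_left] at this
    have := hrD _ ho _ hd
    rw [mul_inv_cancel_left] at this
    exact this.symm
  refine not_isErgodicFamily_of_bijOn (O := hfin.toFinset) ?_ ?_ ?_ herg
  · rw [Set.Finite.toFinset_nonempty]
    exact ⟨_, 1, one_mem _, rfl⟩
  · rw [Set.Finite.mem_toFinset]
    rintro ⟨g, hg, hg1⟩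
    refine hχW ((hB χ).mp (hBY χ fun y hy => ?_))
    have := DFunLike.congr_fun hg1 (⟨(g : MulAut X) y, hg.2 y hy⟩ : Y)
    rw [hr, MulAut.inv_apply_self] at this
    exact this
  · rintro T ⟨γ, hγ, hT⟩
    let c : Γ := ⟨γ, hγ.1⟩
    have hc : c ∈ Δ.subgroupOf Γ := hγ
    let σ := restrictAut (Subgroup.inclusion hΓ c) Y hγ.2 (inv_mem hc : c⁻¹ ∈ Δ.subgroupOf Γ).2
    have hσ : ∀ g : Γ, PontryaginDual.map (continuousAutHom σ) (r g) = r (c⁻¹ * g) := by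
      intro g
      refine PontryaginDual.ext fun y => ?_
      rw [hr, Subgroup.coe_mul, mul_inv_rev, Subgroup.coe_inv, inv_inv]
      rfl
    refine ⟨continuousAutHom σ, funext fun y => Subtype.ext (hT y).symm, ?_, ?_, ?_⟩
    · rw [Set.Finite.coe_toFinset]
      rintro _ ⟨g, hg, rfl⟩
      exact ⟨_, mul_mem (inv_mem hc) hg, (hσ g).symm⟩
    · intro ψ _ ψ' _ hψ
      refine PontryaginDual.ext fun y => ?_
      have := DFunLike.congr_fun hψ ((σ : MulAut Y)⁻¹ y)
      have h1 : continuousAutHom σ ((σ : MulAut Y)⁻¹ y) = y := MulAut.apply_inv_self _ _ _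
      change ψ (continuousAutHom σ _) = ψ' (continuousAutHom σ _) at this
      rwa [h1] at this
    · rw [Set.Finite.coe_toFinset]
      rintro _ ⟨g, hg, rfl⟩
      refine ⟨_, ⟨c * g, mul_mem hc hg, rfl⟩, ?_⟩
      rw [hσ, inv_mul_cancel_left]

theorem IsHereditarilyErgodic.exists_isAperiodic [T2Space X] [ConnectedSpace X]
    [FiniteDimensional ℚ (DualSpace X)] {Γ : Subgroup (MulAut X)} (hΓ : Γ ≤ continuousAut X)
    [Group.IsSolvable Γ] (h : IsHereditarilyErgodic Γ) :
    ∃ g : continuousAut X, (g : MulAut X) ∈ Γ ∧ IsAperiodic g := by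
  obtain ⟨g, hg⟩ := exists_forall_pow_fixed_eq_zero ((dualRep X).comp (Subgroup.inclusion hΓ)) (by
    intro W D hD hW v hv
    obtain ⟨s, hs, χ, hχ⟩ := exists_smul_eq_dualVec v
    rw [← Int.cast_smul_eq_zsmul ℚ] at hχ
    rw [← Submodule.smul_mem_iff W (Int.cast_ne_zero.mpr hs : (s : ℚ) ≠ 0), hχ]
    refine h.dualVec_mem hΓ hD hW fun g hg => ?_
    rw [← hχ, map_smul, ← smul_sub]
    exact W.smul_mem _ (hv g hg))
  exact ⟨Subgroup.inclusion hΓ g, g.2, isAperiodic_iff.mpr fun k hk v hv =>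
    hg k hk v hv⟩

end Ergodicity

theorem mainTheorem9 {X : Type*} [CommGroup X] [TopologicalSpace X] [IsTopologicalGroup X]
    [CompactSpace X] [T2Space X] [ConnectedSpace X] [MeasurableSpace X] [BorelSpace X]
    (hdim : charDim X < Cardinal.aleph0)
    (Γ : Subgroup (MulAut X)) (hΓ : Γ ≤ continuousAut X) (hsolv : Group.IsSolvable Γ) :
    List.TFAE [
      IsHereditarilyErgodic Γ,
      ∃ Λ : Subgroup (MulAut X), Λ ≤ Γ ∧ (∀ a ∈ Λ, ∀ b ∈ Λ, a * b = b * a) ∧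
        IsMixingOfAllOrders Λ,
      ∃ γ ∈ Γ, IsMixingElement γ] := by
  have := finiteDimensional_dualSpace hdim
  tfae_have 1 → 2 := by
    intro h
    obtain ⟨g, hgΓ, hg⟩ := h.exists_isAperiodic hΓ
    refine ⟨Subgroup.zpowers (g : MulAut X), Subgroup.zpowers_le.mpr hgΓ, ?_,
      hg.isMixingOfAllOrders⟩
    rintro _ ⟨a, rfl⟩ _ ⟨b, rfl⟩
    exact zpow_mul_comm _ _ _
  tfae_have 2 → 3 := by
    rintro ⟨Λ, hΛ, hcomm, hmix⟩
    obtain ⟨g, hgΛ, hg⟩ := hmix.exists_isAperiodic (hΛ.trans hΓ) hcomm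
    exact ⟨g, hΛ hgΛ, hg.isMixingElement⟩
  tfae_have 3 → 1 := by
    rintro ⟨γ, hγ, hmix⟩
    exact (IsMixingElement.isAperiodic (g := ⟨γ, hΓ hγ⟩) hmix).isHereditarilyErgodic hγ
  tfae_finish
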